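/- Let $U$ be a finite set and $\phi$ a closure operator on the subsets of $U$. A set $Q\subseteq U$ is quasi-closed if it is not closed and $\phi(A)\subseteq Q$ for every $A\subseteq Q$ with $\phi(A)\subsetneq\phi(Q)$. A closed set is essential if it is the closure of a quasi-closed set. The extreme points of $C$ are $\mathrm{ex}(C)=\{x\in C : x\notin\phi(C\setminus\{x\})\}$. For an essential set $C$, the quasi-closed hypergraph $\mathcal{Q}(C)$ has vertex set $C$ and as edges the sets $C\setminus Q$, where $Q$ runs over the inclusion-wise maximal ones among the quasi-closed sets with closure $C$. The closure system is a convex geometry if $\emptyset$ is closed and for each closed $C\neq U$ there is $x\notin C$ with $C\cup\{x\}$ closed. An implicational base of $\phi$ is a collection of implications $A\to B$ (with $A,B\subseteq U$) such that the closed sets are exactly the sets $C$ for which $A\subseteq C$ implies $B\subseteq C$ for each implication $A\to B$ of the collection; it is optimum if it minimizes $\sum(|A|+|B|)$ among all implicational bases of $\phi$. Consider the following four classes of convex geometries. (1) Double-shelling: the closed sets are the convex subsets of a partial order on $U$. (2) Acyclic: the convex geometry has an implicational base whose implication-graph (an arc from $a$ to $b$ whenever $a\in A$ and $b\in B$ for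 some implication $A\to B$ of the base) has no directed cycle, loops included. (3) Affine: $U$ is a finite set of points of some $\mathbb{R}^d$, and $\phi(Y)$ is the set of points of $U$ in the convex hull of $Y$. (4) Acceptant: for some $q$ with $1\le q\le |U|$, the convex geometry is $q$-acceptant, that is, $|\mathrm{ex}(C)|=\min(q,|C|)$ for every closed set $C$. Theorem. In each of the four classes, for every essential set $C$, the edges of $\mathcal{Q}(C)$ are pairwise disjoint. More precisely, for every essential set $C$: (1) if the closed sets are the convex subsets of a partial order on $U$, then there are $x<y$ with $\mathrm{ex}(C)=\{x,y\}$ and $C=[x,y]$, and the edges of $\mathcal{Q}(C)$ are exactly the connected components of the comparability graph induced on $[x,y]\setminus\{x,y\}$; (2) in an acyclic convex geometry, every edge of $\mathcal{Q}(C)$ is a singleton; (3) in an affine convex geometry, $\mathrm{ex}(C)$ is the unique maximal quasi-closed set of $C$, so that $C\setminus\mathrm{ex}(C)$ is the only edge of $\mathcal{Q}(C)$; (4) in an acceptant convex geometry, $C$ has a unique maximal quasi-closed set, so that $\mathcal{Q}(C)$ has exactly one edge. Consequently, there is a polynomial-time algorithm that, given any implicational base of a convex geometry in any of the four classes, outputs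 an optimum implicational base of the same convex geometry. -/

import Mathlib

/-! Closure systems on a finite ground set, quasi-closed hypergraphs, four classes of convex
geometries, implicational bases, and a cost-annotated programming language used to speak about
polynomial time. -/

namespace ConvexGeom

section ClosureSystems

variable {α : Type*} [Fintype α] [DecidableEq α]

/-- A closure system on `α` is given by its closure operator `c`. It is a convex geometry if `∅` is
closed and each closed set other than the ground set can be extended to a closed set by adding
one element. -/
def IsConvexGeometry (c : ClosureOperator (Finset α)) : Prop :=
  c.IsClosed ∅ ∧
    ∀ C : Finset α, c.IsClosed C → C ≠ Finset.univ → ∃ x, x ∉ C ∧ c.IsClosed (insert x C)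

/-- The set of extreme points of `A`. -/
def extremePoints (c : ClosureOperator (Finset α)) (A : Finset α) : Finset α :=
  A.filter fun x => x ∉ c (A.erase x)

/-- `Q` is quasi-closed: it is not closed, and it contains the closure of each of its subsets `A`
whose closure is strictly smaller than the closure of `Q`. -/
def IsQuasiClosed (c : ClosureOperator (Finset α)) (Q : Finset α) : Prop :=
  ¬ c.IsClosed Q ∧ ∀ A : Finset α, A ⊆ Q → c A ⊂ c Q → c A ⊆ Q

/-- `C` is essential: it is the closure of a quasi-closed set. -/
def IsEssential (c : ClosureOperator (Finset α)) (C : Finset α) : Prop :=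
  ∃ Q : Finset α, IsQuasiClosed c Q ∧ c Q = C

/-- `Q` is an inclusion-wise maximal quasi-closed set of `C`, that is, inclusion-wise maximal among
the quasi-closed sets whose closure is `C`. -/
def IsMaximalQuasiClosedOf (c : ClosureOperator (Finset α)) (C Q : Finset α) : Prop :=
  Maximal (fun Q' : Finset α => IsQuasiClosed c Q' ∧ c Q' = C) Q

/-- The edge set of the quasi-closed hypergraph of `C` (whose vertex set is `C`): the complements in
`C` of the maximal quasi-closed sets of `C`. -/
def qcEdges (c : ClosureOperator (Finset α)) (C : Finset α) : Set (Finset α) :=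
  {E | ∃ Q : Finset α, IsMaximalQuasiClosedOf c C Q ∧ E = C \ Q}

/-- A collection of implications `A → B`, each one written as the pair `(A, B)`. -/
abbrev ImplBase (α : Type*) := Finset (Finset α × Finset α)

/-- `S` is an implicational base of the closure system of `c`: the closed sets are exactly the sets
that satisfy all the implications of `S`. -/
def IsBaseOf (S : ImplBase α) (c : ClosureOperator (Finset α)) : Prop :=
  ∀ C : Finset α, c.IsClosed C ↔ ∀ i ∈ S, i.1 ⊆ C → i.2 ⊆ C

/-- The total size: the sum of the sizes of all premises and conclusions. -/
def totalSize (S : ImplBase α) : ℕ :=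
  ∑ i ∈ S, (i.1.card + i.2.card)

/-- `S` is an optimum implicational base of the closure system of `c`. -/
def IsOptimumBaseOf (S : ImplBase α) (c : ClosureOperator (Finset α)) : Prop :=
  IsBaseOf S c ∧ ∀ S' : ImplBase α, IsBaseOf S' c → totalSize S ≤ totalSize S'

/-- The arcs of the implication-graph of `S`. -/
def ImplArc (S : ImplBase α) (a b : α) : Prop :=
  ∃ i ∈ S, a ∈ i.1 ∧ b ∈ i.2

/-- The implication-graph of `S` has no directed cycle (loops count as cycles). -/
def IsAcyclicBase (S : ImplBase α) : Prop :=
  ∀ a : α, ¬ Relation.TransGen (ImplArc S) a a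

/-- The closed sets of `c` are the convex subsets of the poset `α`. -/
def IsDoubleShellingOf [PartialOrder α] (c : ClosureOperator (Finset α)) : Prop :=
  ∀ C : Finset α, c.IsClosed C ↔
    ∀ x ∈ C, ∀ y ∈ C, x < y → ∀ z, x ≤ z → z ≤ y → z ∈ C

/-- Double-shelling convex geometries. -/
def IsDoubleShelling (c : ClosureOperator (Finset α)) : Prop :=
  ∃ P : PartialOrder α, @IsDoubleShellingOf α P c

/-- Acyclic convex geometries. -/
def IsAcyclicGeometry (c : ClosureOperator (Finset α)) : Prop :=
  IsConvexGeometry c ∧ ∃ S : ImplBase α, IsBaseOf S c ∧ IsAcyclicBase S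

/-- Affine convex geometries: the ground set is identified with a finite set of points of some
`ℝ ^ d`, and the closure of `Y` consists of the points that lie in the convex hull of `Y`. -/
def IsAffineGeometry (c : ClosureOperator (Finset α)) : Prop :=
  ∃ (d : ℕ) (p : α → EuclideanSpace ℝ (Fin d)), Function.Injective p ∧
    ∀ (Y : Finset α) (x : α), x ∈ c Y ↔ p x ∈ convexHull ℝ (p '' (Y : Set α))

/-- `q`-acceptant convex geometries. -/
def IsAcceptantWith (q : ℕ) (c : ClosureOperator (Finset α)) : Prop :=
  IsConvexGeometry c ∧ 1 ≤ q ∧ q ≤ Fintype.card α ∧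
    ∀ C : Finset α, c.IsClosed C → (extremePoints c C).card = min q C.card

/-- Acceptant convex geometries. -/
def IsAcceptant (c : ClosureOperator (Finset α)) : Prop :=
  ∃ q : ℕ, IsAcceptantWith q c

end ClosureSystems

/-- The comparability graph of a poset. -/
def comparabilityGraph (α : Type*) [PartialOrder α] : SimpleGraph α where
  Adj a b := a < b ∨ b < a
  symm := ⟨fun _ _ h => h.symm⟩
  loopless := ⟨fun a h => h.elim (lt_irrefl a) (lt_irrefl a)⟩

/-- The vertex sets of the connected components of the comparability graph induced on
`[x, y] \ {x, y}`. -/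
def intervalComponents {α : Type*} [PartialOrder α] (x y : α) : Set (Finset α) :=
  {E | ∃ K : ((comparabilityGraph α).induce (Set.Ioo x y)).ConnectedComponent,
    (E : Set α) = Subtype.val '' K.supp}

/-! ### Computation

The machine model is the language of `while` programs over binary trees. Every operation is charged
the sizes of all the trees it handles, so that program time and Turing machine time are
polynomially related. -/

/-- Binary trees, the values that programs manipulate. -/
inductive Data : Type
  | nil : Data
  | cons : Data → Data → Data
deriving DecidableEq

namespace Data

/-- The number of nodes, leaves included. -/
def size : Data → ℕ
  | nil => 1
  | cons a b => a.size + b.size + 1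

/-- The left child; `nil` for a leaf. -/
def hd : Data → Data
  | nil => nil
  | cons a _ => a

/-- The right child; `nil` for a leaf. -/
def tl : Data → Data
  | nil => nil
  | cons _ b => b

/-- Truth values: `nil` is false. -/
def ofBool : Bool → Data
  | false => nil
  | true => cons nil nil

/-- The tree of a list whose entries are encoded by `f`. -/
def ofList {β : Type*} (f : β → Data) : List β → Data
  | [] => nil
  | b :: l => cons (f b) (ofList f l)

/-- A natural number, as the list of its binary digits. -/
def ofNat (m : ℕ) : Data := ofList ofBool m.bits

end Data

/-- A store assigns a tree to each program variable. -/
abbrev Store := ℕ → Data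

/-- Expressions of the programming language. -/
inductive Exp : Type
  | var : ℕ → Exp
  | nil : Exp
  | cons : Exp → Exp → Exp
  | hd : Exp → Exp
  | tl : Exp → Exp
  | eq : Exp → Exp → Exp

namespace Exp

/-- The value of an expression. -/
def eval (s : Store) : Exp → Data
  | var i => s i
  | nil => Data.nil
  | cons e f => Data.cons (e.eval s) (f.eval s)
  | hd e => (e.eval s).hd
  | tl e => (e.eval s).tl
  | eq e f => Data.ofBool (decide (e.eval s = f.eval s))

/-- The cost of evaluating an expression: the sum of the sizes of the values of all of its
subexpressions, the expression itself included. -/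
def cost (s : Store) : Exp → ℕ
  | var i => (s i).size
  | nil => 1
  | cons e f => e.cost s + f.cost s + ((cons e f).eval s).size
  | hd e => e.cost s + ((hd e).eval s).size
  | tl e => e.cost s + ((tl e).eval s).size
  | eq e f => e.cost s + f.cost s + ((eq e f).eval s).size

end Exp

/-- Programs. -/
inductive Prog : Type
  | assign : ℕ → Exp → Prog
  | seq : Prog → Prog → Prog
  | cond : Exp → Prog → Prog → Prog
  | loop : Exp → Prog → Prog

/-- `Exec p s k s'`: started in the store `s`, the program `p` halts in the store `s'`, at the total
cost `k`. The program `loop e p` repeats `p` as long as the value of `e` is not `nil`. -/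
inductive Exec : Prog → Store → ℕ → Store → Prop
  | assign (i : ℕ) (e : Exp) (s : Store) :
      Exec (.assign i e) s (e.cost s + 1) (Function.update s i (e.eval s))
  | seq {p q : Prog} {s s' s'' : Store} {k l : ℕ} :
      Exec p s k s' → Exec q s' l s'' → Exec (.seq p q) s (k + l) s''
  | cond_true {e : Exp} {p q : Prog} {s s' : Store} {k : ℕ} :
      e.eval s ≠ Data.nil → Exec p s k s' → Exec (.cond e p q) s (e.cost s + 1 + k) s'
  | cond_false {e : Exp} {p q : Prog} {s s' : Store} {k : ℕ} :
      e.eval s = Data.nil → Exec q s k s' → Exec (.cond e p q) s (e.cost s + 1 + k) s'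
  | loop_stop {e : Exp} {p : Prog} {s : Store} :
      e.eval s = Data.nil → Exec (.loop e p) s (e.cost s + 1) s
  | loop_step {e : Exp} {p : Prog} {s s' s'' : Store} {k l : ℕ} :
      e.eval s ≠ Data.nil → Exec p s k s' → Exec (.loop e p) s' l s'' →
        Exec (.loop e p) s (e.cost s + 1 + k + l) s''

/-- On input `t`, stored in variable `0` with all other variables `nil`, the program `p` halts at
the total cost `k` with output `t'` in variable `0`. -/
def RunsTo (p : Prog) (t : Data) (k : ℕ) (t' : Data) : Prop :=
  ∃ s' : Store, Exec p (Function.update (fun _ => Data.nil) 0 t) k s' ∧ s' 0 = t'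

/-- The tree of the ground set `{0, …, n - 1}` and a list of implications over it, each one given by
the lists of elements of its premise and of its conclusion. -/
def encodeBase (n : ℕ) (L : List (List (Fin n) × List (Fin n))) : Data :=
  Data.cons (Data.ofList Data.ofNat (List.range n))
    (Data.ofList (fun i => Data.cons (Data.ofList (fun x : Fin n => Data.ofNat x) i.1)
      (Data.ofList (fun x : Fin n => Data.ofNat x) i.2)) L)

/-- The tree `t` represents the implicational base `({0, …, n - 1}, S)`: it encodes a list of the
implications of `S`, in any order and without repetitions, the premise and the conclusion of each one
being listed in any order and without repetitions. -/
def Represents {n : ℕ} (t : Data) (S : ImplBase (Fin n)) : Prop :=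
  ∃ L : List (List (Fin n) × List (Fin n)),
    (∀ i ∈ L, i.1.Nodup ∧ i.2.Nodup) ∧
    (L.map fun i => (i.1.toFinset, i.2.toFinset)).Nodup ∧
    (L.map fun i => (i.1.toFinset, i.2.toFinset)).toFinset = S ∧
    t = encodeBase n L

/-- A class `K` of closure systems can be optimized in polynomial time: one program turns every
implicational base of every closure system in `K` into an optimum implicational base of the same
closure system, at a cost that is polynomial in the size of the input. -/
def OptimizableInPolyTime
    (K : ∀ n : ℕ, ClosureOperator (Finset (Fin n)) → Prop) : Prop :=
  ∃ (p : Prog) (T : Polynomial ℕ),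
    ∀ (n : ℕ) (c : ClosureOperator (Finset (Fin n))) (S : ImplBase (Fin n)) (t : Data),
      K n c → IsBaseOf S c → Represents t S →
        ∃ (k : ℕ) (t' : Data) (S' : ImplBase (Fin n)),
          RunsTo p t k t' ∧ k ≤ T.eval t.size ∧ Represents t' S' ∧ IsOptimumBaseOf S' c

end ConvexGeom

/-!
In all four classes each closed set `C` is generated by its extreme points `ex C`, so that `ex C`
is contained in every quasi-closed set with closure `C`. The edges are then found class by class.

* In a poset, a violated convexity condition in a quasi-closed set shows that its closure is an
  interval `[x, y]`; a set that contains `x` and `y` is quasi-closed with this closure if and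
  only if it is a proper subset of `[x, y]` whose part strictly between `x` and `y` is a union
  of components of the comparability graph (`IsDoubleShellingOf.isQuasiClosed_iff`).
* In the acyclic case, removing from `C` an element of an edge that no other element of the edge
  reaches leaves a quasi-closed set (`IsAcyclicBase.eq_singleton_of_mem_qcEdges`).
* In the affine case, a point of a polytope other than its vertices splits it into polytopes
  that each miss a vertex, so that a quasi-closed set has no points but the vertices
  (`IsAffineGeometry.eq_extremePoints`).
* In the acceptant case, for `e ∈ ex C` the closed sets between `ex C \ {e}` and `C \ {e}`
  form a chain, hence so do the quasi-closed sets with closure `C`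
  (`IsAcceptantWith.quasiClosed_subset_or_subset`).

For the optimization, replace every implication `A → B` by the implications `ex (c A) → {b}` with
`b ∈ c A`, drop implications one by one as long as the rest is still a base, and merge the
implications with the same premise. In the resulting base, each element of the conclusion of `ex
C` is the only one to hit some edge of the quasi-closed hypergraph of `C`. Any other base spends
at least `|ex C|` elements on a premise with closure `C`, and the conclusions of its implications
with such premises hit all those edges, which are pairwise disjoint. So the base is optimum
(`IsUnitBaseOf.isOptimumBaseOf_aggregate`).

The program is obtained from closure properties of the class `IsPolyTime` of functions on trees:
composition, case distinction, and folding a list, where each step may enlarge the accumulator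
only by an amount that is polynomial in the input (`IsPolyTime.foldl`). Closures are computed by
forward chaining, with one round for each element of the ground set.
-/

namespace ConvexGeom

/-! ### Closure systems and convex geometries -/

section Closure

variable {α : Type*} {c : ClosureOperator (Finset α)}

theorem isClosed_inter [DecidableEq α] {A B : Finset α} (hA : c.IsClosed A) (hB : c.IsClosed B) :
    c.IsClosed (A ∩ B) :=
  c.isClosed_iff_closure_le.2 <| Finset.subset_inter
    (c.closure_min Finset.inter_subset_left hA) (c.closure_min Finset.inter_subset_right hB)

theorem subset_closure (A : Finset α) : A ⊆ c A := c.le_closure A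

theorem mem_extremePoints [DecidableEq α] {A : Finset α} {x : α} :
    x ∈ extremePoints c A ↔ x ∈ A ∧ x ∉ c (A.erase x) := by
  simp [extremePoints]

theorem extremePoints_subset [DecidableEq α] (A : Finset α) : extremePoints c A ⊆ A :=
  Finset.filter_subset _ _

/-- Every generating set of `C` contains the extreme points of `C`. -/
theorem extremePoints_subset_of_closure_eq [DecidableEq α] {C Q : Finset α} (h : c Q = C) :
    extremePoints c C ⊆ Q := by
  intro e he
  rw [mem_extremePoints] at he
  by_contra hQ
  have : Q ⊆ C.erase e := fun x hx => Finset.mem_erase.2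
    ⟨fun h' => hQ (h' ▸ hx), h ▸ subset_closure Q hx⟩
  exact he.2 (c.monotone this (h ▸ he.1))

theorem isClosed_erase_of_mem_extremePoints [DecidableEq α] {C : Finset α} {e : α}
    (hC : c.IsClosed C) (he : e ∈ extremePoints c C) : c.IsClosed (C.erase e) := by
  rw [mem_extremePoints] at he
  refine c.isClosed_iff_closure_le.2 fun x hx => Finset.mem_erase.2 ⟨?_, ?_⟩
  · rintro rfl
    exact he.2 hx
  · exact c.closure_min (Finset.erase_subset _ _) hC hx

theorem extremePoints_inter_subset [DecidableEq α] {C D : Finset α} (h : D ⊆ C) :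
    extremePoints c C ∩ D ⊆ extremePoints c D := by
  intro x hx
  rw [Finset.mem_inter, mem_extremePoints] at hx
  exact mem_extremePoints.2
    ⟨hx.2, fun h' => hx.1.2 (c.monotone (Finset.erase_subset_erase x h) h')⟩

/-- The property of convex geometries on which the optimization rests: every closed set is
generated by its extreme points. -/
def IsGeneratedByExtremePoints [DecidableEq α] (c : ClosureOperator (Finset α)) : Prop :=
  ∀ C : Finset α, c.IsClosed C → c (extremePoints c C) = C

/-- In a convex geometry, a closed set can be reached from a smaller closed set
by adding one element at a time. -/
theorem IsConvexGeometry.exists_insert [Fintype α] [DecidableEq α]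
    (hc : IsConvexGeometry c) {D C : Finset α}
    (hD : c.IsClosed D) (hC : c.IsClosed C) (h : D ⊂ C) :
    ∃ x ∈ C, x ∉ D ∧ c.IsClosed (insert x D) := by
  obtain ⟨M, hM⟩ := (Set.toFinite {M : Finset α | c.IsClosed M ∧ M ∩ C = D}).exists_maximal
    ⟨D, hD, Finset.inter_eq_left.2 h.1⟩
  have hMu : M ≠ Finset.univ := by
    rintro rfl
    have := hM.1.2
    rw [Finset.univ_inter] at this
    exact h.ne this.symm
  obtain ⟨x, hx, hxc⟩ := hc.2 M hM.1.1 hMu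
  have hxC : x ∈ C := by
    by_contra hxC
    have : insert x M ∩ C = D := by rw [Finset.insert_inter_of_notMem hxC, hM.1.2]
    exact hx (hM.2 ⟨hxc, this⟩ (Finset.subset_insert x M) (Finset.mem_insert_self x M))
  refine ⟨x, hxC, ?_, ?_⟩
  · rw [← hM.1.2]
    simp [hx]
  · have := isClosed_inter hxc hC
    rwa [Finset.insert_inter_of_mem hxC, hM.1.2] at this

/-- A minimal generating set `A` of `C` consists of extreme points: each `a ∈ A` is the last element
to be added in some chain of closed sets that leads from `c (A.erase a)` to `C`. -/
theorem IsConvexGeometry.isGeneratedByExtremePoints [Fintype α] [DecidableEq α]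
    (hc : IsConvexGeometry c) :
    IsGeneratedByExtremePoints c := by
  intro C hC
  obtain ⟨A, hA⟩ := (Set.toFinite {A : Finset α | c A = C}).exists_minimal ⟨C, hC.closure_eq⟩
  have hAC : A ⊆ C := hA.1 ▸ subset_closure A
  have key : A ⊆ extremePoints c C := by
    intro a ha
    have haD : a ∉ c (A.erase a) := by
      intro h
      have hsub : A ⊆ c (A.erase a) := fun x hx => by
        by_cases hxa : x = a
        · exact hxa ▸ h
        · exact subset_closure _ (Finset.mem_erase.2 ⟨hxa, hx⟩)
      have h1 : c (A.erase a) = C := by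
        refine le_antisymm (c.closure_min ((Finset.erase_subset _ _).trans hAC) hC) ?_
        rw [← hA.1]
        exact c.closure_min hsub (c.isClosed_closure _)
      exact (Finset.mem_erase.1 (hA.2 h1 (Finset.erase_subset a A) ha)).1 rfl
    -- a maximal closed set avoiding `a` can only be extended by `a`, so it is `C.erase a`
    obtain ⟨M, hM⟩ := (Set.toFinite {M : Finset α | c.IsClosed M ∧ A.erase a ⊆ M ∧ M ⊆ C ∧
      a ∉ M}).exists_maximal ⟨c (A.erase a), c.isClosed_closure _, subset_closure _,
        c.closure_min ((Finset.erase_subset _ _).trans hAC) hC, haD⟩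
    obtain ⟨hMc, hAM, hMC, haM⟩ := hM.1
    obtain ⟨x, hxC, hxM, hx⟩ := hc.exists_insert hMc hC
      ((Finset.ssubset_iff_of_subset hMC).2 ⟨a, hAC ha, haM⟩)
    have hxa : x = a := by
      by_contra hxa
      refine hxM (hM.2 ⟨hx, hAM.trans (Finset.subset_insert _ _),
        Finset.insert_subset hxC hMC, ?_⟩ (Finset.subset_insert x M) (Finset.mem_insert_self x M))
      simp [haM, Ne.symm hxa]
    subst hxa
    have hAx : A ⊆ insert x M := fun y hy => by
      by_cases hyx : y = x
      · simp [hyx]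
      · exact Finset.mem_insert_of_mem (hAM (Finset.mem_erase.2 ⟨hyx, hy⟩))
    have hCx : C ⊆ insert x M := by
      rw [← hA.1]
      exact c.closure_min hAx hx
    refine mem_extremePoints.2 ⟨hAC ha, fun h => hxM ?_⟩
    refine c.closure_min (fun y hy => ?_) hMc h
    rw [Finset.mem_erase] at hy
    exact (Finset.mem_insert.1 (hCx hy.2)).resolve_left hy.1
  refine le_antisymm (c.closure_min (extremePoints_subset C) hC) ?_
  have := c.monotone key
  rwa [hA.1] at this

theorem IsQuasiClosed.closure_ne {Q : Finset α} (h : IsQuasiClosed c Q) : c Q ≠ Q :=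
  fun h' => h.1 (c.isClosed_iff.2 h')

theorem exists_isMaximalQuasiClosedOf [Finite α] {Q : Finset α} (hQ : IsQuasiClosed c Q) :
    ∃ M, Q ⊆ M ∧ IsMaximalQuasiClosedOf c (c Q) M :=
  (Set.toFinite {Q' : Finset α | IsQuasiClosed c Q' ∧ c Q' = c Q}).exists_le_maximal
    (a := Q) ⟨hQ, rfl⟩

/-- A set that is not closed contains a quasi-closed set, cut out by a closed set, on which the
failure of closedness is already visible. -/
theorem exists_isQuasiClosed_inter [Finite α] [DecidableEq α] {X : Finset α} (hX : ¬ c.IsClosed X) :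
    ∃ F, c.IsClosed F ∧ IsQuasiClosed c (X ∩ F) ∧ c (X ∩ F) = F := by
  obtain ⟨F, hF⟩ := (Set.toFinite {F : Finset α | ∃ A ⊆ X, c A = F ∧ ¬ F ⊆ X}).exists_minimal
    ⟨c X, X, subset_rfl, rfl, fun h => hX (c.isClosed_iff_closure_le.2 h)⟩
  obtain ⟨A, hAX, hAF, hFX⟩ := hF.1
  have hFc : c.IsClosed F := hAF ▸ c.isClosed_closure A
  have hcl : c (X ∩ F) = F := by
    refine le_antisymm (c.closure_min Finset.inter_subset_right hFc) ?_
    have : A ⊆ X ∩ F := Finset.subset_inter hAX (hAF ▸ subset_closure A)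
    exact hAF ▸ c.monotone (hAF ▸ this)
  refine ⟨F, hFc, ⟨fun h => hFX ?_, fun B hB hlt => ?_⟩, hcl⟩
  · rw [← hcl, h.closure_eq]
    exact Finset.inter_subset_left
  · rw [hcl] at hlt
    refine Finset.subset_inter ?_ hlt.1
    by_contra hBX
    exact hlt.2 (hF.2 ⟨B, hB.trans Finset.inter_subset_left, rfl, hBX⟩ hlt.1)

/-- If `D` is a closed proper subset of the closure of the quasi-closed set `Q`,
then `Q ∩ D` is closed. -/
theorem IsQuasiClosed.isClosed_inter [DecidableEq α] {Q D : Finset α} (hQ : IsQuasiClosed c Q)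
    (hD : c.IsClosed D) (h : ¬ c Q ⊆ D) : c.IsClosed (Q ∩ D) := by
  have h1 : c (Q ∩ D) ⊆ D := c.closure_min Finset.inter_subset_right hD
  refine c.isClosed_iff_closure_le.2 (Finset.subset_inter ?_ h1)
  refine hQ.2 _ Finset.inter_subset_left ⟨c.monotone Finset.inter_subset_left, fun h' => ?_⟩
  exact h (h'.trans h1)

theorem IsBaseOf.subset_closure {S : ImplBase α} (hS : IsBaseOf S c) {i : Finset α × Finset α}
    (hi : i ∈ S) : i.2 ⊆ c i.1 :=
  (hS _).1 (c.isClosed_closure _) i hi (ConvexGeom.subset_closure _)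

/-- A quasi-closed set violates an implication of every base, and the premise of that implication
has the same closure as the quasi-closed set. -/
theorem IsBaseOf.exists_violated {S : ImplBase α} (hS : IsBaseOf S c) {Q : Finset α}
    (hQ : IsQuasiClosed c Q) : ∃ i ∈ S, i.1 ⊆ Q ∧ ¬ i.2 ⊆ Q ∧ c i.1 = c Q := by
  have h := hQ.1
  rw [hS Q] at h
  push Not at h
  obtain ⟨i, hi, h1, h2⟩ := h
  refine ⟨i, hi, h1, h2, ?_⟩
  by_contra hne
  exact h2 ((hS.subset_closure hi).trans (hQ.2 _ h1 (lt_of_le_of_ne (c.monotone h1) hne)))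

end Closure

/-! ### Acyclic convex geometries -/

section Acyclic

variable {α : Type*} {c : ClosureOperator (Finset α)}

/-- Only the elements of `A` from which `z` can be reached in the implication-graph are needed to
derive `z` from `A`. -/
theorem mem_closure_filter_transGen [Fintype α] {S : ImplBase α} (hS : IsBaseOf S c)
    {A : Finset α} {z : α} [DecidablePred fun a => Relation.TransGen (ImplArc S) a z]
    (hz : z ∈ c A) (hzA : z ∉ A) :
    z ∈ c (A.filter fun a => Relation.TransGen (ImplArc S) a z) := by
  classical
  set B := A.filter fun a => Relation.TransGen (ImplArc S) a z
  let X : Finset α := Finset.univ.filter fun w =>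
    w ∈ c B ∨ ¬ Relation.ReflTransGen (ImplArc S) w z
  have hX : c.IsClosed X := by
    rw [hS]
    intro i hi hiX r hr
    simp only [X, Finset.mem_filter, Finset.mem_univ, true_and]
    by_cases hrz : Relation.ReflTransGen (ImplArc S) r z
    · left
      refine (hS (c B)).1 (c.isClosed_closure _) i hi (fun p hp => ?_) hr
      have := hiX hp
      simp only [X, Finset.mem_filter, Finset.mem_univ, true_and] at this
      exact this.resolve_right (not_not.2 (Relation.ReflTransGen.head ⟨i, hi, hp, hr⟩ hrz))
    · exact Or.inr hrz
  have hAX : A ⊆ X := by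
    intro a ha
    simp only [X, Finset.mem_filter, Finset.mem_univ, true_and]
    by_cases haz : Relation.ReflTransGen (ImplArc S) a z
    · left
      rcases Relation.reflTransGen_iff_eq_or_transGen.1 haz with rfl | h
      · exact absurd ha hzA
      · exact subset_closure _ (Finset.mem_filter.2 ⟨ha, h⟩)
    · exact Or.inr haz
  have := c.closure_min hAX hX hz
  simp only [X, Finset.mem_filter, Finset.mem_univ, true_and] at this
  exact this.resolve_right (not_not.2 Relation.ReflTransGen.refl)

/-- An edge of the quasi-closed hypergraph of `C` contains a source `z` of the implication-graph, in
the sense that no element of the edge reaches `z`. The closure `C` without `z` is then quasi-closed,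
because a derivation of `z` from outside the edge takes place in the given quasi-closed set. -/
theorem IsAcyclicBase.eq_singleton_of_mem_qcEdges [Fintype α] [DecidableEq α] {S : ImplBase α}
    (hac : IsAcyclicBase S) (hS : IsBaseOf S c) {C E : Finset α} (hE : E ∈ qcEdges c C) :
    ∃ x ∈ C, E = {x} := by
  classical
  obtain ⟨Q, hQ, rfl⟩ := hE
  obtain ⟨hqc, hQC⟩ := hQ.1
  have hsub : Q ⊆ C := hQC ▸ subset_closure Q
  have hne : (C \ Q).Nonempty := by
    rw [Finset.sdiff_nonempty]
    intro h
    exact hqc.closure_ne (hQC.trans (h.antisymm hsub))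
  have : Std.Irrefl (Relation.TransGen (ImplArc S)) := ⟨hac⟩
  -- a source of the implication-graph among the elements of the edge
  obtain ⟨z, hz, hmin⟩ := (Finite.wellFounded_of_trans_of_irrefl
    (Relation.TransGen (ImplArc S))).has_min (↑(C \ Q) : Set α) hne
  rw [Finset.mem_coe, Finset.mem_sdiff] at hz
  have hQz : Q ⊆ C.erase z := fun x hx =>
    Finset.mem_erase.2 ⟨fun h => hz.2 (h ▸ hx), hsub hx⟩
  have hcl : c (C.erase z) = C := by
    refine le_antisymm (c.closure_min (Finset.erase_subset _ _) ?_) ?_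
    · exact hQC ▸ c.isClosed_closure Q
    · have := c.monotone hQz
      rwa [hQC] at this
  have hqz : IsQuasiClosed c (C.erase z) := by
    refine ⟨fun h => ?_, fun A hA hlt x hx => ?_⟩
    · rw [h.closure_eq] at hcl
      exact Finset.notMem_erase z C (hcl.symm ▸ hz.1)
    · rw [hcl] at hlt
      refine Finset.mem_erase.2 ⟨?_, hlt.1 hx⟩
      rintro rfl
      have hx' := mem_closure_filter_transGen hS hx (fun h => Finset.notMem_erase x C (hA h))
      set B := A.filter fun a => Relation.TransGen (ImplArc S) a x
      have hBA : B ⊆ A := Finset.filter_subset _ _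
      have hBQ : B ⊆ Q := by
        intro b hb
        by_contra hbQ
        have hbC : b ∈ C := Finset.mem_of_mem_erase (hA (hBA hb))
        exact hmin b (by simp [hbC, hbQ]) (Finset.mem_filter.1 hb).2
      refine hz.2 (hqc.2 B hBQ ?_ hx')
      rw [hQC]
      exact lt_of_le_of_lt (c.monotone hBA) hlt
  refine ⟨z, hz.1, ?_⟩
  have heq : Q = C.erase z := Finset.Subset.antisymm hQz (hQ.2 ⟨hqz, hcl⟩ hQz)
  rw [heq, Finset.sdiff_erase_self hz.1]

end Acyclic

/-! ### Acceptant convex geometries -/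

section Acceptant

variable {α : Type*} {c : ClosureOperator (Finset α)}

/-- Below a closed set `C` of more than `q` elements, the closed sets that contain all the extreme
points of `C` but `e`, and avoid `e`, form a chain. -/
theorem IsAcceptantWith.subset_or_subset [Fintype α] [DecidableEq α] {q : ℕ}
    (hc : IsAcceptantWith q c) {C D₁ D₂ : Finset α} {e : α} (hC : c.IsClosed C)
    (hq : (extremePoints c C).card = q) (he : e ∈ extremePoints c C)
    (h₁ : c.IsClosed D₁) (h₂ : c.IsClosed D₂)
    (he₁ : (extremePoints c C).erase e ⊆ D₁) (he₂ : (extremePoints c C).erase e ⊆ D₂)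
    (hD₁ : D₁ ⊆ C.erase e) (hD₂ : D₂ ⊆ C.erase e) : D₁ ⊆ D₂ ∨ D₂ ⊆ D₁ := by
  set G := c (D₁ ∪ D₂) with hG
  have hGc : c.IsClosed G := c.isClosed_closure _
  have hGC : G ⊆ C := (c.closure_min (Finset.union_subset hD₁ hD₂)
    (isClosed_erase_of_mem_extremePoints hC he)).trans (Finset.erase_subset _ _)
  have hD₁G : D₁ ⊆ G := Finset.subset_union_left.trans (subset_closure _)
  have hD₂G : D₂ ⊆ G := Finset.subset_union_right.trans (subset_closure _)
  have hex : (extremePoints c C).erase e ⊆ extremePoints c G := fun x hx =>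
    extremePoints_inter_subset hGC
      (Finset.mem_inter.2 ⟨Finset.mem_of_mem_erase hx, hD₁G (he₁ hx)⟩)
  have hexG : extremePoints c G ⊆ D₁ ∪ D₂ := extremePoints_subset_of_closure_eq hG.symm
  have hgen := hc.1.isGeneratedByExtremePoints G hGc
  -- apart from the common extreme points there is at most one more, and it lies in `D₁` or `D₂`
  have hcard : (extremePoints c G \ (extremePoints c C).erase e).card ≤ 1 := by
    rw [Finset.card_sdiff_of_subset hex, Finset.card_erase_of_mem he, hq, hc.2.2.2 G hGc]
    have := min_le_left q G.card
    omega
  have key : extremePoints c G ⊆ D₁ ∨ extremePoints c G ⊆ D₂ := by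
    by_contra hcon
    push Not at hcon
    obtain ⟨u, hu, hu₁⟩ := Finset.not_subset.1 hcon.1
    obtain ⟨v, hv, hv₂⟩ := Finset.not_subset.1 hcon.2
    have huv := Finset.card_le_one.1 hcard u
      (Finset.mem_sdiff.2 ⟨hu, fun h => hu₁ (he₁ h)⟩) v
      (Finset.mem_sdiff.2 ⟨hv, fun h => hv₂ (he₂ h)⟩)
    subst huv
    exact (Finset.mem_union.1 (hexG hu)).elim hu₁ hv₂
  rcases key with h | h
  · exact Or.inr (hD₂G.trans (hgen ▸ c.closure_min h h₁))
  · exact Or.inl (hD₁G.trans (hgen ▸ c.closure_min h h₂))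

/-- In an acceptant convex geometry the quasi-closed sets with a given closure form a chain. -/
theorem IsAcceptantWith.quasiClosed_subset_or_subset [Fintype α] [DecidableEq α] {q : ℕ}
    (hc : IsAcceptantWith q c) {C Q₁ Q₂ : Finset α} (h₁ : IsQuasiClosed c Q₁) (hC₁ : c Q₁ = C)
    (h₂ : IsQuasiClosed c Q₂) (hC₂ : c Q₂ = C) : Q₁ ⊆ Q₂ ∨ Q₂ ⊆ Q₁ := by
  have hC : c.IsClosed C := hC₁ ▸ c.isClosed_closure Q₁
  have hE₁ := extremePoints_subset_of_closure_eq hC₁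
  have hE₂ := extremePoints_subset_of_closure_eq hC₂
  have hcard := hc.2.2.2 C hC
  have hQC₁ : Q₁ ⊆ C := hC₁ ▸ subset_closure Q₁
  have hQC₂ : Q₂ ⊆ C := hC₂ ▸ subset_closure Q₂
  have hq : (extremePoints c C).card = q := by
    rcases le_total q C.card with h | h
    · rwa [min_eq_left h] at hcard
    · rw [min_eq_right h] at hcard
      have heq := Finset.eq_of_subset_of_card_le (extremePoints_subset C) hcard.ge
      exact absurd (hC₁.trans ((heq ▸ hE₁).antisymm hQC₁)) h₁.closure_ne
  obtain ⟨e, he⟩ : (extremePoints c C).Nonempty := by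
    rw [← Finset.card_pos, hq]
    exact hc.2.1
  have hCe := isClosed_erase_of_mem_extremePoints hC he
  have hnot : ¬ C ⊆ C.erase e := fun h =>
    Finset.notMem_erase e C (h (extremePoints_subset C he))
  have hi₁ := h₁.isClosed_inter hCe (hC₁ ▸ hnot)
  have hi₂ := h₂.isClosed_inter hCe (hC₂ ▸ hnot)
  have hs : ∀ {Q : Finset α}, extremePoints c C ⊆ Q →
      (extremePoints c C).erase e ⊆ Q ∩ C.erase e := fun hQ x hx =>
    Finset.mem_inter.2 ⟨hQ (Finset.mem_of_mem_erase hx),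
      Finset.erase_subset_erase e (extremePoints_subset C) hx⟩
  have hback : ∀ {P Q : Finset α}, P ⊆ C → extremePoints c C ⊆ Q →
      P ∩ C.erase e ⊆ Q ∩ C.erase e → P ⊆ Q := fun hP hQ h x hx => by
    by_cases hxe : x = e
    · exact hQ (hxe ▸ he)
    · exact (Finset.mem_inter.1
        (h (Finset.mem_inter.2 ⟨hx, Finset.mem_erase.2 ⟨hxe, hP hx⟩⟩))).1
  exact (hc.subset_or_subset hC hq he hi₁ hi₂ (hs hE₁) (hs hE₂) Finset.inter_subset_right
    Finset.inter_subset_right).imp (hback hQC₁ hE₂) (hback hQC₂ hE₁)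

theorem IsAcceptantWith.existsUnique_isMaximalQuasiClosedOf [Fintype α] [DecidableEq α] {q : ℕ}
    (hc : IsAcceptantWith q c) {C : Finset α} (hC : IsEssential c C) :
    ∃! Q, IsMaximalQuasiClosedOf c C Q := by
  obtain ⟨Q, hQ, rfl⟩ := hC
  obtain ⟨M, -, hM⟩ := exists_isMaximalQuasiClosedOf hQ
  refine ⟨M, hM, fun M' hM' => ?_⟩
  rcases hc.quasiClosed_subset_or_subset hM.1.1 hM.1.2 hM'.1.1 hM'.1.2 with h | h
  · exact (hM.2 hM'.1 h).antisymm h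
  · exact h.antisymm (hM'.2 hM.1 h)

end Acceptant

/-! ### Affine convex geometries -/

section Affine

/-- A point `x` of a polytope cuts it into the polytopes obtained by exchanging a generator `e`
for `x`. -/
theorem exists_mem_convexHull_insert_erase {E : Type*} [AddCommGroup E] [Module ℝ E]
    [DecidableEq E] {V : Finset E} {x z : E} (hx : x ∈ convexHull ℝ (V : Set E))
    (hz : z ∈ convexHull ℝ (V : Set E)) :
    ∃ e ∈ V, z ∈ convexHull ℝ (insert x (V.erase e) : Set E) := by
  obtain ⟨l, hl, hl1, rfl⟩ := Finset.mem_convexHull'.1 hz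
  obtain ⟨m, hm, hm1, rfl⟩ := Finset.mem_convexHull'.1 hx
  have hne : (V.filter fun v => 0 < m v).Nonempty := by
    by_contra h
    rw [Finset.not_nonempty_iff_eq_empty, Finset.filter_eq_empty_iff] at h
    have : ∑ v ∈ V, m v ≤ 0 := Finset.sum_nonpos fun v hv => not_lt.1 (h hv)
    linarith
  -- `t` is the largest multiple of the weights of `x` that can be subtracted from those of `z`;
  -- the weight of `e` vanishes then
  obtain ⟨e, he, hmin⟩ := Finset.exists_min_image _ (fun v => l v / m v) hne
  rw [Finset.mem_filter] at he
  set t := l e / m e with ht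
  have ht0 : 0 ≤ t := div_nonneg (hl e he.1) he.2.le
  have hte : l e - t * m e = 0 := by
    rw [ht, div_mul_cancel₀ _ he.2.ne', sub_self]
  have hw : ∀ v ∈ V, 0 ≤ l v - t * m v := by
    intro v hv
    rcases (hm v hv).eq_or_lt with h | h
    · rw [← h, mul_zero, sub_zero]
      exact hl v hv
    · have := hmin v (Finset.mem_filter.2 ⟨hv, h⟩)
      rw [le_div_iff₀ h] at this
      linarith
  refine ⟨e, he.1, ?_⟩
  have key := (convex_convexHull ℝ (insert (∑ y ∈ V, m y • y) (V.erase e) : Set E)).sum_mem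
    (t := V) (w := fun v => (l v - t * m v) + if v = e then t else 0)
    (z := fun v => if v = e then ∑ y ∈ V, m y • y else v) ?_ ?_ ?_
  · convert key using 1
    have h1 : ∀ v ∈ V, ((l v - t * m v) + if v = e then t else 0) •
        (if v = e then ∑ y ∈ V, m y • y else v) =
        (l v • v - t • (m v • v)) + if v = e then t • ∑ y ∈ V, m y • y else 0 := by
      intro v hv
      by_cases hve : v = e
      · subst hve
        have : l v • v - t • (m v • v) = 0 := by
          rw [smul_smul, ← sub_smul, hte, zero_smul]
        simp [hte, this]
      · simp [hve, sub_smul, smul_smul]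
    rw [Finset.sum_congr rfl h1, Finset.sum_add_distrib, Finset.sum_sub_distrib,
      ← Finset.smul_sum, Finset.sum_ite_eq' V e, if_pos he.1]
    abel
  · intro v hv
    have := hw v hv
    split_ifs <;> linarith
  · rw [Finset.sum_add_distrib, Finset.sum_sub_distrib, ← Finset.mul_sum, hl1, hm1,
      Finset.sum_ite_eq' V e, if_pos he.1]
    ring
  · intro v hv
    apply subset_convexHull
    split_ifs with hve
    · exact Set.mem_insert _ _
    · exact Set.mem_insert_of_mem _ (by simpa [hve] using hv)

variable {α : Type*} {c : ClosureOperator (Finset α)}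

/-- The Krein–Milman theorem for polytopes. -/
theorem IsAffineGeometry.isGeneratedByExtremePoints [DecidableEq α]
    (hc : IsAffineGeometry c) : IsGeneratedByExtremePoints c := by
  obtain ⟨d, p, hp, h⟩ := hc
  intro C hC
  refine le_antisymm (c.closure_min (extremePoints_subset C) hC) fun x hx => ?_
  have hfin : (p '' (C : Set α)).Finite := (Finset.finite_toSet C).image p
  have hKM := closure_convexHull_extremePoints (hfin.isCompact_convexHull (𝕜 := ℝ))
    (convex_convexHull ℝ (p '' (C : Set α)))
  have hsub : (convexHull ℝ (p '' (C : Set α))).extremePoints ℝ ⊆ p '' (extremePoints c C) := by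
    intro v hv
    obtain ⟨a, ha, rfl⟩ := extremePoints_convexHull_subset hv
    refine ⟨a, Finset.mem_coe.2 (mem_extremePoints.2 ⟨ha, fun hac => ?_⟩), rfl⟩
    rw [h] at hac
    have hconv := ((convex_convexHull ℝ _).mem_extremePoints_iff_convex_sdiff.1 hv).2
    refine (convexHull_min ?_ hconv hac).2 rfl
    rintro _ ⟨b, hb, rfl⟩
    rw [Finset.mem_coe, Finset.mem_erase] at hb
    exact ⟨subset_convexHull ℝ _ ⟨b, hb.2, rfl⟩, fun hba => hb.1 (hp hba)⟩
  rw [h]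
  have hx' : p x ∈ convexHull ℝ (p '' (C : Set α)) := subset_convexHull ℝ _ ⟨x, hx, rfl⟩
  rw [← hKM] at hx'
  have hfin' : (p '' (extremePoints c C : Set α)).Finite := (Finset.finite_toSet _).image p
  exact closure_minimal (convexHull_mono hsub) (hfin'.isClosed_convexHull (𝕜 := ℝ)) hx'

/-- In an affine convex geometry the extreme points of the closure are the only quasi-closed
generating set: any further point `x` of a quasi-closed set splits the polytope into smaller ones,
each one missing an extreme point. -/
theorem IsAffineGeometry.eq_extremePoints [DecidableEq α] (hc : IsAffineGeometry c)
    {C Q : Finset α} (hQ : IsQuasiClosed c Q) (hQC : c Q = C) : Q = extremePoints c C := by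
  classical
  have hC : c.IsClosed C := hQC ▸ c.isClosed_closure Q
  have hgen := hc.isGeneratedByExtremePoints C hC
  have hEQ := extremePoints_subset_of_closure_eq hQC
  have hQs : Q ⊆ C := hQC ▸ subset_closure Q
  obtain ⟨d, p, hp, h⟩ := hc
  refine Finset.Subset.antisymm (fun x hx => ?_) hEQ
  by_contra hxE
  refine hQ.closure_ne (hQC.trans (Finset.Subset.antisymm (fun z hz => ?_) hQs))
  have hull : ∀ y ∈ C,
      p y ∈ convexHull ℝ (((extremePoints c C).image p : Finset _) : Set _) := by
    intro y hy
    rw [Finset.coe_image, ← h, hgen]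
    exact hy
  obtain ⟨_, hpe, hzc⟩ := exists_mem_convexHull_insert_erase (hull x (hQs hx)) (hull z hz)
  obtain ⟨e, he, rfl⟩ := Finset.mem_image.1 hpe
  have hset : (insert (p x) (((extremePoints c C).image p).erase (p e) : Finset _) : Set _) =
      p '' ((insert x ((extremePoints c C).erase e) : Finset α) : Set α) := by
    rw [← Finset.image_erase hp, Finset.coe_image, Finset.coe_insert, Set.image_insert_eq]
  rw [hset, ← h] at hzc
  have hle : insert x ((extremePoints c C).erase e) ⊆ C.erase e := by
    refine Finset.insert_subset (Finset.mem_erase.2 ⟨fun hxe => hxE (hxe ▸ he), hQs hx⟩) ?_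
    exact Finset.erase_subset_erase e (extremePoints_subset C)
  refine hQ.2 _ ?_ ?_ hzc
  · exact Finset.insert_subset hx ((Finset.erase_subset _ _).trans hEQ)
  · rw [hQC]
    refine lt_of_le_of_lt
      (c.closure_min hle (isClosed_erase_of_mem_extremePoints hC he)) ?_
    exact Finset.erase_ssubset (extremePoints_subset C he)

theorem IsAffineGeometry.isMaximalQuasiClosedOf_iff [DecidableEq α] (hc : IsAffineGeometry c)
    {C : Finset α} (hC : IsEssential c C) (Q : Finset α) :
    IsMaximalQuasiClosedOf c C Q ↔ Q = extremePoints c C := by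
  refine ⟨fun h => hc.eq_extremePoints h.1.1 h.1.2, ?_⟩
  obtain ⟨Q', hQ', hC'⟩ := hC
  have hEq := hc.eq_extremePoints hQ' hC'
  rintro rfl
  refine ⟨hEq ▸ ⟨hQ', hC'⟩, fun R hR _ => (hc.eq_extremePoints hR.1 hR.2).le⟩

end Affine

/-! ### Double-shelling convex geometries -/

section DoubleShelling

variable {α : Type*} [PartialOrder α] {c : ClosureOperator (Finset α)}

theorem IsDoubleShellingOf.mem_closure_pair [Fintype α] [DecidableEq α]
    (hc : IsDoubleShellingOf c) {x y : α} (hxy : x < y) (z : α) :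
    z ∈ c {x, y} ↔ x ≤ z ∧ z ≤ y := by
  classical
  constructor
  · intro hz
    have hcl : c.IsClosed (Finset.univ.filter fun w => x ≤ w ∧ w ≤ y) := by
      rw [hc]
      intro u hu v hv _ w huw hwv
      simp only [Finset.mem_filter, Finset.mem_univ, true_and] at hu hv ⊢
      exact ⟨hu.1.trans huw, hwv.trans hv.2⟩
    have hsub : ({x, y} : Finset α) ⊆ Finset.univ.filter fun w => x ≤ w ∧ w ≤ y := by
      intro w hw
      simp only [Finset.mem_insert, Finset.mem_singleton] at hw
      rcases hw with rfl | rfl <;> simp [hxy.le]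
    simpa using c.closure_min hsub hcl hz
  · rintro ⟨h1, h2⟩
    exact (hc _).1 (c.isClosed_closure _) x (subset_closure _ (by simp)) y
      (subset_closure _ (by simp)) hxy z h1 h2

theorem IsDoubleShellingOf.mem_extremePoints_of_min_or_max [DecidableEq α]
    (hc : IsDoubleShellingOf c) {C : Finset α} (hC : c.IsClosed C) {a : α} (ha : a ∈ C)
    (h : (∀ b ∈ C, b ≤ a → b = a) ∨ (∀ b ∈ C, a ≤ b → b = a)) : a ∈ extremePoints c C := by
  refine mem_extremePoints.2 ⟨ha, fun hac => ?_⟩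
  have hcl : c.IsClosed (C.erase a) := by
    rw [hc]
    intro u hu v hv huv w huw hwv
    rw [Finset.mem_erase] at hu hv ⊢
    refine ⟨?_, (hc C).1 hC u hu.2 v hv.2 huv w huw hwv⟩
    rintro rfl
    exact h.elim (fun h => hu.1 (h u hu.2 huw)) (fun h => hv.1 (h v hv.2 hwv))
  rw [hcl.closure_eq] at hac
  exact Finset.notMem_erase a C hac

theorem IsDoubleShellingOf.isGeneratedByExtremePoints [DecidableEq α]
    (hc : IsDoubleShellingOf c) : IsGeneratedByExtremePoints c := by
  intro C hC
  refine le_antisymm (c.closure_min (extremePoints_subset C) hC) fun z hz => ?_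
  obtain ⟨a, haz, ha⟩ := (Finset.finite_toSet C).exists_le_minimal hz
  obtain ⟨b, hzb, hb⟩ := (Finset.finite_toSet C).exists_le_maximal hz
  have ha' := subset_closure (c := c) _ (hc.mem_extremePoints_of_min_or_max hC ha.1
    (Or.inl fun w hw hwa => hwa.antisymm (ha.2 hw hwa)))
  have hb' := subset_closure (c := c) _ (hc.mem_extremePoints_of_min_or_max hC hb.1
    (Or.inr fun w hw hbw => (hb.2 hw hbw).antisymm hbw))
  rcases (haz.trans hzb).eq_or_lt with h | h
  · exact (le_antisymm haz (h ▸ hzb)) ▸ ha'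
  · exact (hc _).1 (c.isClosed_closure _) a ha' b hb' h z haz hzb

theorem IsDoubleShellingOf.exists_closure_pair [Fintype α] [DecidableEq α]
    (hc : IsDoubleShellingOf c) {Q : Finset α} (hQ : IsQuasiClosed c Q) :
    ∃ x y, x < y ∧ c {x, y} = c Q := by
  have h := hQ.1
  rw [hc] at h
  push Not at h
  obtain ⟨x, hx, y, hy, hxy, z, hxz, hzy, hz⟩ := h
  refine ⟨x, y, hxy, ?_⟩
  have hsub : ({x, y} : Finset α) ⊆ Q := by
    simp [Finset.insert_subset_iff, hx, hy]
  by_contra hne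
  exact hz (hQ.2 _ hsub (lt_of_le_of_ne (c.monotone hsub) hne)
    ((hc.mem_closure_pair hxy z).2 ⟨hxz, hzy⟩))

theorem IsDoubleShellingOf.extremePoints_closure_pair [Fintype α] [DecidableEq α]
    (hc : IsDoubleShellingOf c) {x y : α} (hxy : x < y) :
    extremePoints c (c {x, y}) = {x, y} := by
  refine (extremePoints_subset_of_closure_eq rfl).antisymm fun z hz => ?_
  refine hc.mem_extremePoints_of_min_or_max (c.isClosed_closure _) (subset_closure _ hz) ?_
  simp only [Finset.mem_insert, Finset.mem_singleton] at hz
  rcases hz with rfl | rfl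
  · exact Or.inl fun b hb h => h.antisymm ((hc.mem_closure_pair hxy b).1 hb).1
  · exact Or.inr fun b hb h => ((hc.mem_closure_pair hxy b).1 hb).2.antisymm h

/-- The quasi-closed sets of an interval are its proper subsets that contain both ends and are,
strictly between the ends, closed under comparability. -/
theorem IsDoubleShellingOf.isQuasiClosed_iff [Fintype α] [DecidableEq α]
    (hc : IsDoubleShellingOf c) {x y : α} (hxy : x < y) (Q : Finset α) :
    (IsQuasiClosed c Q ∧ c Q = c {x, y}) ↔
      x ∈ Q ∧ y ∈ Q ∧ Q ⊆ c {x, y} ∧ Q ≠ c {x, y} ∧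
        ∀ u ∈ Q, u ∈ Set.Ioo x y → ∀ v ∈ Set.Ioo x y, (u < v ∨ v < u) → v ∈ Q := by
  have hmem := hc.mem_closure_pair hxy
  constructor
  · rintro ⟨hQ, hcl⟩
    have hex := extremePoints_subset_of_closure_eq hcl
    rw [hc.extremePoints_closure_pair hxy] at hex
    have hx : x ∈ Q := hex (by simp)
    have hy : y ∈ Q := hex (by simp)
    refine ⟨hx, hy, hcl ▸ subset_closure Q, fun h => hQ.closure_ne (hcl.trans h.symm), ?_⟩
    intro u hu huI v hvI huv
    rcases huv with huv | hvu
    · refine hQ.2 {u, y} (by simp [Finset.insert_subset_iff, hu, hy]) ?_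
        ((hc.mem_closure_pair huI.2 v).2 ⟨huv.le, hvI.2.le⟩)
      refine lt_of_le_of_ne (c.monotone (by simp [Finset.insert_subset_iff, hu, hy])) fun h => ?_
      have : x ∈ c {u, y} := h ▸ subset_closure Q hx
      exact absurd ((hc.mem_closure_pair huI.2 x).1 this).1 huI.1.not_ge
    · refine hQ.2 {x, u} (by simp [Finset.insert_subset_iff, hu, hx]) ?_
        ((hc.mem_closure_pair huI.1 v).2 ⟨hvI.1.le, hvu.le⟩)
      refine lt_of_le_of_ne (c.monotone (by simp [Finset.insert_subset_iff, hu, hx])) fun h => ?_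
      have : y ∈ c {x, u} := h ▸ subset_closure Q hy
      exact absurd ((hc.mem_closure_pair huI.1 y).1 this).2 huI.2.not_ge
  · rintro ⟨hx, hy, hQC, hne, hcomp⟩
    have hcl : c Q = c {x, y} :=
      le_antisymm (c.closure_min hQC (c.isClosed_closure _))
        (c.monotone (by simp [Finset.insert_subset_iff, hx, hy]))
    refine ⟨⟨fun h => hne (h.closure_eq.symm.trans hcl), fun A hA hlt => ?_⟩, hcl⟩
    -- removing one end of the interval from `Q` leaves a convex set
    have herase : ∀ a, a = x ∨ a = y → c.IsClosed (Q.erase a) := by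
      intro a ha
      rw [hc]
      intro u hu v hv huv w huw hwv
      rw [Finset.mem_erase] at hu hv ⊢
      have huC := (hmem u).1 (hQC hu.2)
      have hvC := (hmem v).1 (hQC hv.2)
      refine ⟨?_, ?_⟩
      · rintro rfl
        rcases ha with rfl | rfl
        · exact hu.1 (huw.antisymm huC.1)
        · exact hv.1 (hvC.2.antisymm hwv)
      rcases huw.eq_or_lt with rfl | huw
      · exact hu.2
      rcases hwv.eq_or_lt with rfl | hwv
      · exact hv.2
      have hwI : w ∈ Set.Ioo x y := ⟨huC.1.trans_lt huw, hwv.trans_le hvC.2⟩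
      rcases ha with rfl | rfl
      · exact hcomp u hu.2 ⟨lt_of_le_of_ne huC.1 (Ne.symm hu.1), huw.trans hwI.2⟩ w hwI
          (Or.inl huw)
      · exact hcomp v hv.2 ⟨hwI.1.trans hwv, lt_of_le_of_ne hvC.2 hv.1⟩ w hwI (Or.inr hwv)
    have hfin : ∀ a, a = x ∨ a = y → a ∉ A → c A ⊆ Q := fun a ha haA =>
      (c.closure_min (Finset.subset_erase.2 ⟨hA, haA⟩) (herase a ha)).trans
        (Finset.erase_subset _ _)
    by_cases hxA : x ∈ A
    · by_cases hyA : y ∈ A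
      · rw [hcl] at hlt
        exact absurd (c.monotone (show ({x, y} : Finset α) ≤ A by
          simp [Finset.insert_subset_iff, hxA, hyA])) hlt.not_ge
      · exact hfin y (Or.inr rfl) hyA
    · exact hfin x (Or.inl rfl) hxA

/-- A property that passes from an element of the interval to comparable ones is constant on the
connected components. -/
theorem mem_of_reachable {x y : α} {P : α → Prop}
    (hP : ∀ u, P u → u ∈ Set.Ioo x y → ∀ v ∈ Set.Ioo x y, (u < v ∨ v < u) → P v)
    {u v : Set.Ioo x y} (h : ((comparabilityGraph α).induce (Set.Ioo x y)).Reachable u v)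
    (hu : P u) : P v := by
  rw [SimpleGraph.reachable_iff_reflTransGen] at h
  induction h with
  | refl => exact hu
  | tail _ hab ih => exact hP _ ih (Subtype.property _) _ (Subtype.property _) hab

theorem IsDoubleShellingOf.qcEdges_eq_intervalComponents [Fintype α] [DecidableEq α]
    (hc : IsDoubleShellingOf c) {x y : α} (hxy : x < y) :
    qcEdges c (c {x, y}) = intervalComponents x y := by
  classical
  have hmem := hc.mem_closure_pair hxy
  -- the complement of a connected component is quasi-closed
  have hcompl : ∀ (K : ((comparabilityGraph α).induce (Set.Ioo x y)).ConnectedComponent)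
      (E : Finset α), (E : Set α) = Subtype.val '' K.supp →
      IsQuasiClosed c (c {x, y} \ E) ∧ c (c {x, y} \ E) = c {x, y} := by
    intro K E hE
    have hEI : ∀ w ∈ E, ∃ h : w ∈ Set.Ioo x y,
        ((comparabilityGraph α).induce (Set.Ioo x y)).connectedComponentMk ⟨w, h⟩ = K := by
      intro w hw
      rw [← Finset.mem_coe, hE] at hw
      obtain ⟨⟨w, hw'⟩, h, rfl⟩ := hw
      exact ⟨hw', h⟩
    have hIE : ∀ w : Set.Ioo x y,
        ((comparabilityGraph α).induce (Set.Ioo x y)).connectedComponentMk w = K →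
        (w : α) ∈ E := by
      intro w hw
      rw [← Finset.mem_coe, hE]
      exact ⟨w, hw, rfl⟩
    rw [hc.isQuasiClosed_iff hxy]
    refine ⟨?_, ?_, Finset.sdiff_subset, ?_, ?_⟩
    · exact Finset.mem_sdiff.2 ⟨(hmem x).2 ⟨le_rfl, hxy.le⟩, fun h =>
        lt_irrefl _ (hEI x h).1.1⟩
    · exact Finset.mem_sdiff.2 ⟨(hmem y).2 ⟨hxy.le, le_rfl⟩, fun h =>
        lt_irrefl _ (hEI y h).1.2⟩
    · intro h
      induction K using SimpleGraph.ConnectedComponent.ind with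
      | _ w =>
        have hwE := hIE w rfl
        have hwC : (w : α) ∈ c {x, y} := (hmem w).2 ⟨w.2.1.le, w.2.2.le⟩
        rw [← h] at hwC
        exact (Finset.mem_sdiff.1 hwC).2 hwE
    · intro u hu huI v hvI huv
      refine Finset.mem_sdiff.2 ⟨(hmem v).2 ⟨hvI.1.le, hvI.2.le⟩, fun hvE => ?_⟩
      obtain ⟨_, hvK⟩ := hEI v hvE
      refine (Finset.mem_sdiff.1 hu).2 (hIE ⟨u, huI⟩ ?_)
      rw [← hvK]
      exact SimpleGraph.ConnectedComponent.sound (SimpleGraph.Adj.reachable huv)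
  ext E
  constructor
  · rintro ⟨Q, hQ, rfl⟩
    obtain ⟨hx, hy, hQC, hne, hcomp⟩ := (hc.isQuasiClosed_iff hxy Q).1 hQ.1
    obtain ⟨z, hzC, hzQ⟩ := Finset.exists_of_ssubset (lt_of_le_of_ne hQC hne)
    have hzI : z ∈ Set.Ioo x y := by
      have := (hmem z).1 hzC
      exact ⟨lt_of_le_of_ne this.1 (fun h => hzQ (h ▸ hx)),
        lt_of_le_of_ne this.2 (fun h => hzQ (h ▸ hy))⟩
    set K := ((comparabilityGraph α).induce (Set.Ioo x y)).connectedComponentMk ⟨z, hzI⟩ with hK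
    have hKQ : ∀ w : Set.Ioo x y, w ∈ K.supp → (w : α) ∉ Q := by
      intro w hw hwQ
      exact hzQ (mem_of_reachable (P := (· ∈ Q)) hcomp
        (SimpleGraph.ConnectedComponent.exact hw) hwQ)
    have hcoe : (((Finset.univ.filter fun w => w ∈ Subtype.val '' K.supp) : Finset α) : Set α) =
        Subtype.val '' K.supp := by
      ext w
      simp
    set F : Finset α := Finset.univ.filter fun w => w ∈ Subtype.val '' K.supp with hF
    have hQF : Q ⊆ c {x, y} \ F := by
      intro w hw
      refine Finset.mem_sdiff.2 ⟨hQC hw, fun hwF => ?_⟩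
      rw [← Finset.mem_coe, hcoe] at hwF
      obtain ⟨w, hwK, rfl⟩ := hwF
      exact hKQ w hwK hw
    have heq : Q = c {x, y} \ F := hQF.antisymm (hQ.2 (hcompl K F hcoe) hQF)
    refine ⟨K, ?_⟩
    rw [← hcoe, heq, sdiff_sdiff_right_self, Finset.inf_eq_inter]
    congr 1
    refine Finset.inter_eq_right.2 fun w hw => ?_
    rw [← Finset.mem_coe, hcoe] at hw
    obtain ⟨w, -, rfl⟩ := hw
    exact (hmem w).2 ⟨w.2.1.le, w.2.2.le⟩
  · rintro ⟨K, hE⟩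
    have hEC : E ⊆ c {x, y} := by
      intro w hw
      rw [← Finset.mem_coe, hE] at hw
      obtain ⟨w, -, rfl⟩ := hw
      exact (hmem w).2 ⟨w.2.1.le, w.2.2.le⟩
    refine ⟨c {x, y} \ E, ⟨hcompl K E hE, fun Q' hQ' hle => ?_⟩, ?_⟩
    · obtain ⟨hx, hy, hQC, hne, hcomp⟩ := (hc.isQuasiClosed_iff hxy Q').1 hQ'
      refine Finset.subset_sdiff.2 ⟨hQC, Finset.disjoint_left.2 fun v hvQ hvE => hne ?_⟩
      rw [← Finset.mem_coe, hE] at hvE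
      obtain ⟨v, hvK, rfl⟩ := hvE
      refine hQC.antisymm fun w hw => ?_
      by_cases hwE : w ∈ E
      · rw [← Finset.mem_coe, hE] at hwE
        obtain ⟨w, hwK, rfl⟩ := hwE
        exact mem_of_reachable (P := (· ∈ Q')) hcomp
          (SimpleGraph.ConnectedComponent.exact (hvK.trans hwK.symm)) hvQ
      · exact hle (Finset.mem_sdiff.2 ⟨hw, hwE⟩)
    · rw [sdiff_sdiff_right_self, Finset.inf_eq_inter, Finset.inter_eq_right.2 hEC]

theorem intervalComponents_pairwiseDisjoint [DecidableEq α] (x y : α) :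
    (intervalComponents x y).PairwiseDisjoint (id : Finset α → Finset α) := by
  rintro E ⟨K, hE⟩ E' ⟨K', hE'⟩ hne
  refine Finset.disjoint_left.2 fun w hw hw' => hne ?_
  simp only [id] at hw hw'
  rw [← Finset.mem_coe, hE] at hw
  rw [← Finset.mem_coe, hE'] at hw'
  obtain ⟨w, hK, rfl⟩ := hw
  obtain ⟨w', hK', hww⟩ := hw'
  obtain rfl := Subtype.ext hww
  have : K = K' := SimpleGraph.ConnectedComponent.eq_of_common_vertex hK hK'
  exact Finset.coe_injective (hE.trans (this ▸ hE'.symm))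

end DoubleShelling

/-! ### The four classes together -/

section AllClasses

variable {α : Type*} {c : ClosureOperator (Finset α)}

/-- The union of the four classes of convex geometries. -/
def IsInFourClasses [Fintype α] [DecidableEq α]
    (c : ClosureOperator (Finset α)) : Prop :=
  IsDoubleShelling c ∨ IsAcyclicGeometry c ∨ IsAffineGeometry c ∨ IsAcceptant c

theorem IsInFourClasses.isGeneratedByExtremePoints [Fintype α] [DecidableEq α]
    (hc : IsInFourClasses c) :
    IsGeneratedByExtremePoints c := by
  rcases hc with ⟨P, h⟩ | h | h | ⟨q, h⟩
  · exact h.isGeneratedByExtremePoints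
  · exact h.1.isGeneratedByExtremePoints
  · exact h.isGeneratedByExtremePoints
  · exact h.1.isGeneratedByExtremePoints

theorem IsAffineGeometry.qcEdges_eq [DecidableEq α] (hc : IsAffineGeometry c) {C : Finset α}
    (hC : IsEssential c C) : qcEdges c C = {C \ extremePoints c C} := by
  ext E
  simp [qcEdges, hc.isMaximalQuasiClosedOf_iff hC]

theorem IsAcceptant.exists_qcEdges_eq [Fintype α] [DecidableEq α]
    (hc : IsAcceptant c) {C : Finset α}
    (hC : IsEssential c C) : ∃ E, qcEdges c C = {E} := by
  obtain ⟨q, h⟩ := hc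
  obtain ⟨Q, hQ, huniq⟩ := h.existsUnique_isMaximalQuasiClosedOf hC
  refine ⟨C \ Q, Set.ext fun E => ⟨?_, ?_⟩⟩
  · rintro ⟨Q', hQ', rfl⟩
    rw [huniq Q' hQ', Set.mem_singleton_iff]
  · rintro rfl
    exact ⟨Q, hQ, rfl⟩

theorem IsInFourClasses.pairwiseDisjoint_qcEdges [Fintype α] [DecidableEq α]
    (hc : IsInFourClasses c) {C : Finset α}
    (hC : IsEssential c C) : (qcEdges c C).PairwiseDisjoint id := by
  rcases hc with ⟨P, h⟩ | h | h | h
  · obtain ⟨Q, hQ, rfl⟩ := hC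
    obtain ⟨x, y, hxy, hcl⟩ := h.exists_closure_pair hQ
    rw [← hcl, h.qcEdges_eq_intervalComponents hxy]
    exact intervalComponents_pairwiseDisjoint x y
  · obtain ⟨-, S, hS, hac⟩ := h
    intro E hE E' hE' hne
    obtain ⟨x, -, rfl⟩ := hac.eq_singleton_of_mem_qcEdges hS hE
    obtain ⟨x', -, rfl⟩ := hac.eq_singleton_of_mem_qcEdges hS hE'
    have hx : x ≠ x' := fun h => hne (by rw [h])
    exact Finset.disjoint_singleton.2 hx
  · rw [h.qcEdges_eq hC]
    exact Set.pairwiseDisjoint_singleton _ _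
  · obtain ⟨E, hE⟩ := h.exists_qcEdges_eq hC
    rw [hE]
    exact Set.pairwiseDisjoint_singleton _ _

end AllClasses

/-! ### Unit bases, and optimality of irredundant ones -/

section UnitBase

variable {α : Type*} {c : ClosureOperator (Finset α)}

/-- The set `X` satisfies all the implications `A → {b}`, for `(A, b) ∈ S`. -/
def Satisfies (S : Finset (Finset α × α)) (X : Finset α) : Prop :=
  ∀ i ∈ S, i.1 ⊆ X → i.2 ∈ X

/-- An implicational base all of whose conclusions are singletons; the implication `A → {b}` is
written as the pair `(A, b)`. -/
def IsUnitBaseOf (S : Finset (Finset α × α)) (c : ClosureOperator (Finset α)) : Prop :=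
  ∀ C : Finset α, c.IsClosed C ↔ Satisfies S C

/-- The implicational base obtained from a unit base by merging implications with the same
premise. -/
def aggregate [Fintype α] [DecidableEq α] (S : Finset (Finset α × α)) : ImplBase α :=
  (S.image Prod.fst).image fun P => (P, Finset.univ.filter fun b => (P, b) ∈ S)

/-- The unit base that has the premise `ex (c A)` and every element of `c A` as a conclusion, for
every premise `A` of `S`. -/
def saturatedUnits [DecidableEq α] (S : ImplBase α) (c : ClosureOperator (Finset α)) :
    Finset (Finset α × α) :=
  S.biUnion fun i => (c i.1).image fun b => (extremePoints c (c i.1), b)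

theorem Satisfies.mono {S T : Finset (Finset α × α)} (h : S ⊆ T) {X : Finset α}
    (hX : Satisfies T X) : Satisfies S X := fun i hi => hX i (h hi)

theorem mem_aggregate [Fintype α] [DecidableEq α] {S : Finset (Finset α × α)}
    {i : Finset α × Finset α} :
    i ∈ aggregate S ↔ (∃ b, (i.1, b) ∈ S) ∧ ∀ b, b ∈ i.2 ↔ (i.1, b) ∈ S := by
  obtain ⟨P, B⟩ := i
  simp only [aggregate, Finset.mem_image, Prod.exists, exists_and_right, exists_eq_right,
    Prod.mk.injEq]
  constructor
  · rintro ⟨P', h, rfl, rfl⟩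
    exact ⟨h, by simp⟩
  · rintro ⟨h, hB⟩
    exact ⟨P, h, rfl, by ext b; simp [hB]⟩

theorem IsUnitBaseOf.isBaseOf_aggregate [Fintype α] [DecidableEq α] {S : Finset (Finset α × α)}
    (hS : IsUnitBaseOf S c) : IsBaseOf (aggregate S) c := by
  intro C
  rw [hS]
  constructor
  · intro h i hi hiC b hb
    exact h (i.1, b) (((mem_aggregate.1 hi).2 b).1 hb) hiC
  · rintro h ⟨P, b⟩ hi hiC
    have hmem : (P, Finset.univ.filter fun b => (P, b) ∈ S) ∈ aggregate S :=
      mem_aggregate.2 ⟨⟨b, hi⟩, by simp⟩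
    exact h _ hmem hiC (by simpa using hi)

theorem isUnitBaseOf_saturatedUnits [DecidableEq α] {S : ImplBase α} (hS : IsBaseOf S c)
    (hc : IsGeneratedByExtremePoints c) : IsUnitBaseOf (saturatedUnits S c) c := by
  intro C
  constructor
  · intro hC j hj hjC
    simp only [saturatedUnits, Finset.mem_biUnion, Finset.mem_image] at hj
    obtain ⟨i, hi, b, hb, rfl⟩ := hj
    have := c.closure_min hjC hC
    rw [hc _ (c.isClosed_closure _)] at this
    exact this hb
  · intro hC
    rw [hS]
    intro i hi hiC b hb
    refine hC (extremePoints c (c i.1), b) ?_ ((extremePoints_subset_of_closure_eq rfl).trans hiC)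
    simp only [saturatedUnits, Finset.mem_biUnion, Finset.mem_image]
    exact ⟨i, hi, b, hS.subset_closure hi hb, rfl⟩

theorem fst_eq_of_mem_saturatedUnits [DecidableEq α] {S : ImplBase α}
    (hc : IsGeneratedByExtremePoints c) {i : Finset α × α} (hi : i ∈ saturatedUnits S c) :
    i.1 = extremePoints c (c i.1) := by
  simp only [saturatedUnits, Finset.mem_biUnion, Finset.mem_image] at hi
  obtain ⟨i, hi, b, hb, rfl⟩ := hi
  rw [hc _ (c.isClosed_closure _)]

theorem IsUnitBaseOf.of_subset {S T : Finset (Finset α × α)} (hS : IsUnitBaseOf S c)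
    (hT : IsUnitBaseOf T c) {R : Finset (Finset α × α)} (h₁ : S ⊆ R) (h₂ : R ⊆ T) :
    IsUnitBaseOf R c := fun C =>
  ⟨fun hC => ((hT C).1 hC).mono h₂, fun hC => (hS C).2 (hC.mono h₁)⟩

/-- An implication that cannot be dropped from a unit base is the only one with its premise to hit
some edge of the quasi-closed hypergraph of the closure of that premise. -/
theorem IsUnitBaseOf.exists_edge [Finite α] [DecidableEq α] {S : Finset (Finset α × α)}
    (hS : IsUnitBaseOf S c) {P : Finset α} {b : α} (hirr : ¬ IsUnitBaseOf (S.erase (P, b)) c) :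
    IsEssential c (c P) ∧ ∃ E ∈ qcEdges c (c P), ∀ b', (P, b') ∈ S → b' ∈ E → b' = b := by
  obtain ⟨X, hX, hXS⟩ : ∃ X, ¬ c.IsClosed X ∧ Satisfies (S.erase (P, b)) X := by
    by_contra hcon
    push Not at hcon
    exact hirr fun C => ⟨fun hC => ((hS C).1 hC).mono (Finset.erase_subset _ _),
      fun hC => by_contra fun h => hcon C h hC⟩
  obtain ⟨F, hF, hQ, hQF⟩ := exists_isQuasiClosed_inter hX
  set Q := X ∩ F
  have hQS : Satisfies (S.erase (P, b)) Q := fun i hi hiQ => Finset.mem_inter.2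
    ⟨hXS i hi (hiQ.trans Finset.inter_subset_left),
      (hS F).1 hF i (Finset.mem_of_mem_erase hi) (hiQ.trans Finset.inter_subset_right)⟩
  have hviol : ∀ M, IsQuasiClosed c M → ∃ i ∈ S, i.1 ⊆ M ∧ i.2 ∉ M ∧ c i.1 = c M := by
    intro M hM
    have h := hM.1
    rw [hS M] at h
    simp only [Satisfies] at h
    push Not at h
    obtain ⟨i, hi, h1, h2⟩ := h
    refine ⟨i, hi, h1, h2, ?_⟩
    by_contra hne
    refine h2 (hM.2 _ h1 (lt_of_le_of_ne (c.monotone h1) hne) ?_)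
    exact (hS _).1 (c.isClosed_closure _) i hi (subset_closure _)
  have honly : ∀ i ∈ S, i.1 ⊆ Q → i.2 ∉ Q → i = (P, b) := fun i hi h1 h2 =>
    by_contra fun hne => h2 (hQS i (Finset.mem_erase.2 ⟨hne, hi⟩) h1)
  obtain ⟨i, hiS, hiQ, hiQ', hcl⟩ := hviol Q hQ
  obtain rfl := honly i hiS hiQ hiQ'
  obtain ⟨M, hQM, hM⟩ := exists_isMaximalQuasiClosedOf hQ
  rw [← hcl] at hM
  refine ⟨⟨Q, hQ, hcl.symm⟩, c P \ M, ⟨M, hM, rfl⟩, fun b' hb' hb'E => ?_⟩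
  have := honly (P, b') hb' hiQ (fun h => (Finset.mem_sdiff.1 hb'E).2 (hQM h))
  exact (Prod.mk.injEq _ _ _ _ ▸ this).2

/-- A base hits every edge of the quasi-closed hypergraph of `C` by the conclusion of an implication
whose premise generates `C`. -/
theorem IsBaseOf.exists_mem_edge [DecidableEq α] {S : ImplBase α} (hS : IsBaseOf S c)
    {C E : Finset α} (hE : E ∈ qcEdges c C) : ∃ i ∈ S, c i.1 = C ∧ ∃ x ∈ i.2, x ∈ E := by
  obtain ⟨Q, hQ, rfl⟩ := hE
  obtain ⟨i, hi, hiQ, hiQ', hcl⟩ := hS.exists_violated hQ.1.1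
  obtain ⟨x, hx, hxQ⟩ := Finset.not_subset.1 hiQ'
  rw [hQ.1.2] at hcl
  exact ⟨i, hi, hcl, x, hx, Finset.mem_sdiff.2 ⟨hcl ▸ hS.subset_closure hi hx, hxQ⟩⟩

/-- When the edges of the quasi-closed hypergraphs are pairwise disjoint, irredundancy is enough for
optimality: each element of a conclusion owns an edge, and any other base must spend
an element on that edge as well. -/
theorem IsUnitBaseOf.isOptimumBaseOf_aggregate [Fintype α] [DecidableEq α]
    {S : Finset (Finset α × α)} (hS : IsUnitBaseOf S c)
    (hdisj : ∀ C, IsEssential c C → (qcEdges c C).PairwiseDisjoint id)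
    (hex : ∀ i ∈ S, i.1 = extremePoints c (c i.1))
    (hirr : ∀ i ∈ S, ¬ IsUnitBaseOf (S.erase i) c) : IsOptimumBaseOf (aggregate S) c := by
  refine ⟨hS.isBaseOf_aggregate, fun S' hS' => ?_⟩
  have hlocal : ∀ i ∈ aggregate S,
      i.1.card + i.2.card ≤ ∑ j ∈ S' with c j.1 = c i.1, (j.1.card + j.2.card) := by
    rintro ⟨P, B⟩ hi
    obtain ⟨⟨b₀, hb₀⟩, hB⟩ := mem_aggregate.1 hi
    dsimp only at hb₀ hB ⊢
    have hess := (hS.exists_edge (hirr _ hb₀)).1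
    rw [Finset.sum_add_distrib]
    have hedge : ∀ b : α, ∃ E x, b ∈ B → E ∈ qcEdges c (c P) ∧
        (∀ b' ∈ B, b' ∈ E → b' = b) ∧ x ∈ E ∧ ∃ j ∈ S', c j.1 = c P ∧ x ∈ j.2 := by
      intro b
      by_cases hb : b ∈ B
      · have hbS := (hB b).1 hb
        obtain ⟨-, E, hE, hEb⟩ := hS.exists_edge (hirr _ hbS)
        obtain ⟨j, hj, hjP, x, hx, hxE⟩ := hS'.exists_mem_edge hE
        exact ⟨E, x, fun _ => ⟨hE, fun b' hb' => hEb b' ((hB b').1 hb'), hxE, j, hj, hjP, hx⟩⟩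
      · exact ⟨∅, b, fun h => absurd h hb⟩
    choose E x hEx using hedge
    -- the base hits its own edge `E b` in `b`, so that distinct elements own distinct edges
    have hbE : ∀ b ∈ B, b ∈ E b := by
      intro b hb
      obtain ⟨i, hi, hcl, y, hy, hyE⟩ := hS.isBaseOf_aggregate.exists_mem_edge (hEx b hb).1
      obtain ⟨⟨b₁, hb₁⟩, hi2⟩ := mem_aggregate.1 hi
      have hP : i.1 = P := by
        exact (hex _ hb₁).trans ((congrArg _ hcl).trans (hex _ hb₀).symm)
      have hyB : y ∈ B := (hB y).2 (hP ▸ (hi2 y).1 hy)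
      exact (hEx b hb).2.1 y hyB hyE ▸ hyE
    have hxinj : Set.InjOn x B := by
      intro b hb b' hb' hxx
      by_contra hne
      have hEE : E b ≠ E b' := fun h => hne ((hEx b' hb').2.1 b hb (h ▸ hbE b hb))
      have := hdisj _ hess (hEx b hb).1 (hEx b' hb').1 hEE
      exact Finset.disjoint_left.1 this (hEx b hb).2.2.1 (hxx ▸ (hEx b' hb').2.2.1)
    refine add_le_add ?_ ?_
    · obtain ⟨j, hj, hjP, -⟩ := (hEx b₀ ((hB b₀).2 hb₀)).2.2.2
      have h1 : P ⊆ j.1 := by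
        exact (hex _ hb₀).trans_subset (extremePoints_subset_of_closure_eq hjP)
      exact (Finset.card_le_card h1).trans
        (Finset.single_le_sum (f := fun j : Finset α × Finset α => j.1.card)
          (fun _ _ => Nat.zero_le _) (Finset.mem_filter.2 ⟨hj, hjP⟩))
    · rw [← Finset.card_image_of_injOn hxinj]
      refine le_trans (Finset.card_le_card ?_)
        (Finset.card_biUnion_le (s := S'.filter fun j => c j.1 = c P) (t := Prod.snd))
      intro y hy
      obtain ⟨b, hb, rfl⟩ := Finset.mem_image.1 hy
      obtain ⟨j, hj, hjP, hxj⟩ := (hEx b hb).2.2.2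
      exact Finset.mem_biUnion.2 ⟨j, Finset.mem_filter.2 ⟨hj, hjP⟩, hxj⟩
  refine (Finset.sum_le_sum hlocal).trans ?_
  rw [← Finset.sum_biUnion]
  · refine Finset.sum_le_sum_of_subset fun j hj => ?_
    obtain ⟨i, -, hj⟩ := Finset.mem_biUnion.1 hj
    exact Finset.filter_subset _ _ hj
  · intro i hi i' hi' hne
    refine Finset.disjoint_left.2 fun j hj hj' => hne ?_
    obtain ⟨⟨b, hb⟩, h2⟩ := mem_aggregate.1 hi
    obtain ⟨⟨b', hb'⟩, h2'⟩ := mem_aggregate.1 hi'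
    have h1 : i.1 = i'.1 := by
      rw [hex _ hb, hex _ hb']
      exact congrArg _ ((Finset.mem_filter.1 hj).2.symm.trans (Finset.mem_filter.1 hj').2)
    refine Prod.ext h1 (Finset.ext fun x => ?_)
    rw [h2, h2', h1]

open Classical in
/-- Greedy pruning: an implication is dropped as soon as the remaining ones still form a base. -/
noncomputable def prune (c : ClosureOperator (Finset α)) (l : List (Finset α × α))
    (S : Finset (Finset α × α)) : Finset (Finset α × α) :=
  l.foldl (fun S i => if IsUnitBaseOf (S.erase i) c then S.erase i else S) S

/-- Pruning yields an irredundant base: an implication that was needed when it was examined is still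
needed after the removal of others. -/
theorem prune_spec [DecidableEq α] (l : List (Finset α × α)) {S : Finset (Finset α × α)}
    (hS : IsUnitBaseOf S c) :
    IsUnitBaseOf (prune c l S) c ∧ prune c l S ⊆ S ∧
      ∀ i ∈ l, i ∈ prune c l S → ¬ IsUnitBaseOf ((prune c l S).erase i) c := by
  classical
  induction l generalizing S with
  | nil => exact ⟨hS, subset_rfl, by simp⟩
  | cons i l ih =>
    have hcons : prune c (i :: l) S =
        prune c l (if IsUnitBaseOf (S.erase i) c then S.erase i else S) := by
      simp only [prune, List.foldl_cons]
      congr!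
    rw [hcons]
    split_ifs with h
    · obtain ⟨h1, h2, h3⟩ := ih h
      refine ⟨h1, h2.trans (Finset.erase_subset _ _), fun j hj hjm => ?_⟩
      rcases List.mem_cons.1 hj with rfl | hj
      · exact absurd (h2 hjm) (Finset.notMem_erase _ _)
      · exact h3 j hj hjm
    · obtain ⟨h1, h2, h3⟩ := ih hS
      refine ⟨h1, h2, fun j hj hjm hb => ?_⟩
      rcases List.mem_cons.1 hj with rfl | hj
      · exact h (hb.of_subset hS (Finset.erase_subset_erase _ h2) (Finset.erase_subset _ _))
      · exact h3 j hj hjm hb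

/-- An implication can be dropped if and only if it follows from the remaining ones, that is, if its
conclusion lies in the set `Y` generated from its premise by the remaining implications. -/
theorem IsUnitBaseOf.erase_iff [DecidableEq α] {S : Finset (Finset α × α)}
    (hS : IsUnitBaseOf S c) {i : Finset α × α} (hi : i.2 ∈ c i.1) {Y : Finset α}
    (h₁ : i.1 ⊆ Y) (h₂ : Satisfies (S.erase i) Y)
    (h₃ : ∀ Z, i.1 ⊆ Z → Satisfies (S.erase i) Z → Y ⊆ Z) :
    IsUnitBaseOf (S.erase i) c ↔ i.2 ∈ Y := by
  constructor
  · intro h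
    exact c.closure_min h₁ ((h Y).2 h₂) hi
  · intro hY C
    refine ⟨fun hC => ((hS C).1 hC).mono (Finset.erase_subset _ _), fun hC => (hS C).2 ?_⟩
    intro j hj hjC
    by_cases hji : j = i
    · subst hji
      exact h₃ C hjC hC hY
    · exact hC j (Finset.mem_erase.2 ⟨hji, hj⟩) hjC

end UnitBase

/-! ### Functions on trees that programs compute in polynomial time -/

section PolyTime

theorem eval_mono (T : Polynomial ℕ) {a b : ℕ} (h : a ≤ b) : T.eval a ≤ T.eval b := by
  rw [Polynomial.eval_eq_sum_range, Polynomial.eval_eq_sum_range]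
  exact Finset.sum_le_sum fun i _ => Nat.mul_le_mul_left _ (Nat.pow_le_pow_left h i)

theorem Data.size_hd_le (d : Data) : d.hd.size ≤ d.size := by
  cases d
  · exact le_rfl
  · simp only [Data.hd, Data.size]
    omega

theorem Data.size_tl_le (d : Data) : d.tl.size ≤ d.size := by
  cases d
  · exact le_rfl
  · simp only [Data.tl, Data.size]
    omega

/-- The program `p` computes the function `f`, with input and output in variable `0`: from every
store it halts, it changes no variable from `m` on, and both its cost and the size of the output
are at most `T` of the size of the input. The variables below `m` may hold arbitrary values at the
start, so that such programs can be run one after the other. -/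
def Computes (p : Prog) (m : ℕ) (f : Data → Data) (T : Polynomial ℕ) : Prop :=
  ∀ s : Store, ∃ k s', Exec p s k s' ∧ s' 0 = f (s 0) ∧ (∀ i, m ≤ i → s' i = s i) ∧
    k ≤ T.eval (s 0).size ∧ (f (s 0)).size ≤ T.eval (s 0).size

/-- The function `f` on trees is computed by some program in polynomial time. -/
def IsPolyTime (f : Data → Data) : Prop :=
  ∃ (p : Prog) (m : ℕ) (T : Polynomial ℕ), 0 < m ∧ Computes p m f T

theorem Computes.mono {p : Prog} {m m' : ℕ} {f : Data → Data} {T : Polynomial ℕ}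
    (h : Computes p m f T) (hm : m ≤ m') : Computes p m' f T := by
  intro s
  obtain ⟨k, s', h1, h2, h3, h4, h5⟩ := h s
  exact ⟨k, s', h1, h2, fun i hi => h3 i (hm.trans hi), h4, h5⟩

/-- An expression in the variable `0` is computed by a single assignment. -/
theorem IsPolyTime.of_exp {f : Data → Data} (e : Exp) (T : Polynomial ℕ)
    (he : ∀ s : Store, e.eval s = f (s 0)) (hcost : ∀ s : Store, e.cost s + 1 ≤ T.eval (s 0).size)
    (hsize : ∀ d : Data, (f d).size ≤ T.eval d.size) : IsPolyTime f := by
  refine ⟨.assign 0 e, 1, T, one_pos, fun s => ⟨_, _, Exec.assign 0 e s, ?_, ?_, hcost s,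
    hsize _⟩⟩
  · simp [he]
  · intro i hi
    exact Function.update_of_ne (by omega) _ _

theorem IsPolyTime.id : IsPolyTime fun d => d := by
  refine .of_exp (.var 0) (.X + 1) (fun s => rfl) (fun s => ?_) fun d => ?_ <;>
  simp [Exp.cost]

theorem IsPolyTime.nil : IsPolyTime fun _ => Data.nil := by
  refine .of_exp .nil 2 (fun s => rfl) (fun s => ?_) fun d => ?_ <;>
  simp [Exp.cost, Data.size]

theorem IsPolyTime.comp {f g : Data → Data} (hf : IsPolyTime f) (hg : IsPolyTime g) :
    IsPolyTime fun d => f (g d) := by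
  obtain ⟨p, m, T, hm, hp⟩ := hf
  obtain ⟨p', m', T', hm', hp'⟩ := hg
  refine ⟨.seq p' p, max m m', T' + T.comp T', lt_max_of_lt_left hm, fun s => ?_⟩
  obtain ⟨k', s', h1', h2', h3', h4', h5'⟩ := hp'.mono (le_max_right m m') s
  obtain ⟨k, s'', h1, h2, h3, h4, h5⟩ := hp.mono (le_max_left m m') s'
  rw [h2'] at h2 h4 h5
  have hT := eval_mono T h5'
  refine ⟨k' + k, s'', .seq h1' h1, h2, fun i hi => (h3 i hi).trans (h3' i hi), ?_, ?_⟩ <;>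
  · rw [Polynomial.eval_add, Polynomial.eval_comp]
    beta_reduce
    omega

theorem IsPolyTime.hd {f : Data → Data} (hf : IsPolyTime f) : IsPolyTime fun d => (f d).hd := by
  refine .comp (f := Data.hd) (.of_exp (.hd (.var 0)) (2 * .X + 1) (fun s => rfl) (fun s => ?_)
    fun d => ?_) hf
  · have := (s 0).size_hd_le
    simp [Exp.cost, Exp.eval]
    omega
  · have := d.size_hd_le
    simp
    omega

theorem IsPolyTime.tl {f : Data → Data} (hf : IsPolyTime f) : IsPolyTime fun d => (f d).tl := by
  refine .comp (f := Data.tl) (.of_exp (.tl (.var 0)) (2 * .X + 1) (fun s => rfl) (fun s => ?_)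
    fun d => ?_) hf
  · have := (s 0).size_tl_le
    simp [Exp.cost, Exp.eval]
    omega
  · have := d.size_tl_le
    simp
    omega

/-- Runs `p`, stores its output in the variable `m + 1`, and puts the input back into the variable
`0`, with a copy in the variable `m`. -/
def Prog.keep (p : Prog) (m : ℕ) : Prog :=
  .seq (.assign m (.var 0)) (.seq p (.seq (.assign (m + 1) (.var 0)) (.assign 0 (.var m))))

theorem Computes.keep {p : Prog} {m : ℕ} {f : Data → Data} {T : Polynomial ℕ}
    (h : Computes p m f T) (hm : 0 < m) (s : Store) :
    ∃ k s', Exec (p.keep m) s k s' ∧ s' 0 = s 0 ∧ s' m = s 0 ∧ s' (m + 1) = f (s 0) ∧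
      (∀ i, m + 2 ≤ i → s' i = s i) ∧
      k ≤ 2 * T.eval (s 0).size + 2 * (s 0).size + 3 := by
  obtain ⟨k, s', h1, h2, h3, h4, h5⟩ := h (Function.update s m (s 0))
  have h0 : Function.update s m (s 0) 0 = s 0 := Function.update_of_ne hm.ne _ _
  rw [h0] at h2 h4 h5
  have hsm : s' m = s 0 := by simp [h3]
  refine ⟨_, _, .seq (.assign _ _ _) (.seq h1 (.seq (.assign _ _ _) (.assign _ _ _))),
    ?_, ?_, ?_, ?_, ?_⟩
  · simp [Exp.eval, hsm]
  · simp [Exp.eval, hsm, hm.ne']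
  · simp [Exp.eval, h2]
  · intro i hi
    rw [Function.update_of_ne (by omega), Function.update_of_ne (by omega), h3 i (by omega),
      Function.update_of_ne (by omega)]
  · simp only [Exp.cost, Function.update_of_ne (Nat.ne_of_lt (Nat.lt_succ_self m)), hsm, h2]
    omega

theorem IsPolyTime.cons {f g : Data → Data} (hf : IsPolyTime f) (hg : IsPolyTime g) :
    IsPolyTime fun d => Data.cons (f d) (g d) := by
  obtain ⟨p, m, T, hm, hp⟩ := hf
  obtain ⟨p', m', T', hm', hp'⟩ := hg
  have hM : 0 < max m m' := lt_max_of_lt_left hm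
  refine ⟨.seq (p.keep (max m m')) (.seq p' (.assign 0 (.cons (.var (max m m' + 1)) (.var 0)))),
    max m m' + 2, 4 * T + 4 * T' + 2 * .X + 5, by omega, fun s => ?_⟩
  obtain ⟨k, s₁, h1, h2, h3, h4, h5, h6⟩ := (hp.mono (le_max_left m m')).keep hM s
  obtain ⟨k', s₂, h1', h2', h3', h4', h5'⟩ := hp'.mono (le_max_right m m') s₁
  obtain ⟨-, -, -, -, -, -, hsz⟩ := hp s
  rw [h2] at h2' h4' h5'
  have hf : s₂ (max m m' + 1) = f (s 0) := by rw [h3' _ (by omega), h4]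
  refine ⟨_, _, .seq h1 (.seq h1' (.assign _ _ _)), ?_, ?_, ?_, ?_⟩
  · simp [Exp.eval, hf, h2']
  · intro i hi
    rw [Function.update_of_ne (by omega), h3' i (by omega), h5 i (by omega)]
  · simp only [Exp.cost, Exp.eval, hf, h2', Data.size, Polynomial.eval_add, Polynomial.eval_mul,
      Polynomial.eval_ofNat, Polynomial.eval_X]
    omega
  · simp only [Data.size, Polynomial.eval_add, Polynomial.eval_mul,
      Polynomial.eval_ofNat, Polynomial.eval_X]
    omega

/-- The Boolean function `P` on trees is computed by some program in polynomial time. -/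
def IsPolyBool (P : Data → Bool) : Prop := IsPolyTime fun d => Data.ofBool (P d)

theorem Data.ofBool_eq_nil {b : Bool} : Data.ofBool b = Data.nil ↔ b = false := by
  cases b <;> simp [Data.ofBool]

theorem IsPolyTime.ite {P : Data → Bool} {f g : Data → Data} (hP : IsPolyBool P)
    (hf : IsPolyTime f) (hg : IsPolyTime g) : IsPolyTime fun d => if P d then f d else g d := by
  obtain ⟨p₀, m₀, T₀, hm₀, hp₀⟩ := hP
  obtain ⟨p, m, T, hm, hp⟩ := hf
  obtain ⟨p', m', T', hm', hp'⟩ := hg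
  set M := max m₀ (max m m') with hMdef
  have hM₀ : m₀ ≤ M := le_max_left _ _
  have hM : m ≤ M := (le_max_left _ _).trans (le_max_right _ _)
  have hM' : m' ≤ M := (le_max_right _ _).trans (le_max_right _ _)
  refine ⟨.seq (p₀.keep M) (.cond (.var (M + 1)) p p'), M + 2,
    3 * T₀ + T + T' + 2 * .X + 4, by omega, fun s => ?_⟩
  obtain ⟨k, s₁, h1, h2, h3, h4, h5, h6⟩ := (hp₀.mono hM₀).keep (hm₀.trans_le hM₀) s
  obtain ⟨-, -, -, -, -, -, hsz⟩ := hp₀ s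
  beta_reduce at hsz
  by_cases hPs : P (s 0) = true
  · obtain ⟨k', s₂, h1', h2', h3', h4', h5'⟩ := hp.mono hM s₁
    rw [h2] at h2' h4' h5'
    refine ⟨_, s₂, .seq h1 (.cond_true ?_ h1'), ?_, ?_, ?_, ?_⟩
    · simp [Exp.eval, h4, Data.ofBool_eq_nil, hPs]
    · simp [h2', hPs]
    · intro i hi
      rw [h3' i (by omega), h5 i hi]
    · simp only [Exp.cost, h4, Polynomial.eval_add, Polynomial.eval_mul,
        Polynomial.eval_ofNat, Polynomial.eval_X]
      omega
    · simp only [hPs, if_true, Polynomial.eval_add]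
      omega
  · obtain ⟨k', s₂, h1', h2', h3', h4', h5'⟩ := hp'.mono hM' s₁
    rw [h2] at h2' h4' h5'
    refine ⟨_, s₂, .seq h1 (.cond_false ?_ h1'), ?_, ?_, ?_, ?_⟩
    · simpa [Exp.eval, h4, Data.ofBool_eq_nil] using hPs
    · simp [h2', hPs]
    · intro i hi
      rw [h3' i (by omega), h5 i hi]
    · simp only [Exp.cost, h4, Polynomial.eval_add, Polynomial.eval_mul,
        Polynomial.eval_ofNat, Polynomial.eval_X]
      omega
    · simp only [hPs, Polynomial.eval_add]
      simp only [Bool.false_eq_true, if_false]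
      omega

theorem IsPolyBool.eq {f g : Data → Data} (hf : IsPolyTime f) (hg : IsPolyTime g) :
    IsPolyBool fun d => decide (f d = g d) := by
  have hsz : ∀ b, (Data.ofBool b).size ≤ 3 := fun b => by cases b <;> simp [Data.ofBool, Data.size]
  refine IsPolyTime.comp (f := fun t => Data.ofBool (decide (t.hd = t.tl)))
    (.of_exp (.eq (.hd (.var 0)) (.tl (.var 0))) (4 * .X + 4) (fun s => rfl) (fun s => ?_)
    fun d => ?_) (hf.cons hg)
  · have h1 := (s 0).size_hd_le
    have h2 := (s 0).size_tl_le
    have h3 : ((Exp.eq (.hd (.var 0)) (.tl (.var 0))).eval s).size ≤ 3 := hsz _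
    have h4 : ((Exp.hd (.var 0)).eval s).size = (s 0).hd.size := rfl
    have h5 : ((Exp.tl (.var 0)).eval s).size = (s 0).tl.size := rfl
    simp only [Exp.cost, Polynomial.eval_add, Polynomial.eval_mul,
      Polynomial.eval_ofNat, Polynomial.eval_X]
    omega
  · have h3 := hsz (decide (d.hd = d.tl))
    simp only [Polynomial.eval_add, Polynomial.eval_mul,
      Polynomial.eval_ofNat, Polynomial.eval_X]
    omega

/-- A tree as the list of the trees that hang from its right spine. -/
def Data.toList : Data → List Data
  | .nil => []
  | .cons a b => a :: b.toList

theorem Data.toList_ofList {β : Type*} (f : β → Data) (l : List β) :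
    (Data.ofList f l).toList = l.map f := by
  induction l with
  | nil => rfl
  | cons a l ih => simp [Data.ofList, Data.toList, ih]

theorem Data.ofList_id_toList (d : Data) : Data.ofList _root_.id d.toList = d := by
  induction d with
  | nil => rfl
  | cons a b _ ih => simp [Data.ofList, Data.toList, ih]

theorem Data.length_toList_le (d : Data) : d.toList.length ≤ d.size := by
  induction d with
  | nil => simp [Data.toList]
  | cons a b _ ih =>
    simp only [Data.toList, Data.size, List.length_cons]
    omega

/-- The loop that folds a list, held in the variable `m + 1`, with environment in the variable `m`
and accumulator in the variable `0`. -/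
def Prog.foldLoop (p : Prog) (m : ℕ) : Prog :=
  .loop (.var (m + 1)) (.seq
    (.assign 0 (.cons (.hd (.var (m + 1))) (.cons (.var 0) (.var m))))
    (.seq p (.assign (m + 1) (.tl (.var (m + 1))))))

theorem Computes.foldLoop {p : Prog} {m : ℕ} {g : Data → Data → Data → Data} {T : Polynomial ℕ}
    (h : Computes p m (fun t => g t.hd t.tl.hd t.tl.tl) T) (hm : 0 < m) {A B G : ℕ} {d : Data}
    (hG : ∀ x acc, x.size ≤ B → (g x acc d).size ≤ acc.size + G) (l : Data) :
    ∀ s : Store, s (m + 1) = l → s m = d → l.size ≤ B → (s 0).size + l.toList.length * G ≤ A →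
      ∃ k s', Exec (p.foldLoop m) s k s' ∧
        s' 0 = l.toList.foldl (fun acc x => g x acc d) (s 0) ∧
        (∀ i, m + 2 ≤ i → s' i = s i) ∧
        k ≤ l.toList.length * (T.eval (A + B + d.size + 2) + 6 * (A + B + d.size + 2)) + B + 1 ∧
        (s' 0).size ≤ A := by
  induction l with
  | nil =>
    intro s hl hd hB hA
    refine ⟨_, s, Exec.loop_stop (by simp [Exp.eval, hl]), rfl, fun _ _ => rfl, ?_, ?_⟩
    · simp only [Exp.cost, hl, Data.toList, List.length_nil]
      omega
    · omega
  | cons x l _ ih =>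
    intro s hl hd hB hA
    simp only [Data.toList, List.length_cons, Data.size, Nat.add_mul, one_mul] at hB hA ⊢
    set s₁ := Function.update s 0 (.cons x (.cons (s 0) d)) with hs₁
    have hs₁0 : s₁ 0 = .cons x (.cons (s 0) d) := Function.update_self _ _ _
    obtain ⟨k, s₂, h1, h2, h3, h4, h5⟩ := h s₁
    rw [hs₁0] at h2 h4 h5
    simp only [Data.hd, Data.tl, Data.size] at h2 h4 h5
    have hgx := hG x (s 0) (by omega)
    have hs₂ : s₂ (m + 1) = .cons x l := by
      rw [h3 _ (by omega), hs₁, Function.update_of_ne (by omega), hl]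
    have hs₂m : s₂ m = d := by
      rw [h3 _ le_rfl, hs₁, Function.update_of_ne (by omega), hd]
    set s₃ := Function.update s₂ (m + 1) l with hs₃
    have hs₃0 : s₃ 0 = g x (s 0) d := by
      rw [hs₃, Function.update_of_ne (by omega), h2]
    obtain ⟨k', s₄, h1', h2', h3', h4', h5'⟩ := ih s₃ (Function.update_self _ _ _)
      (by rw [hs₃, Function.update_of_ne (by omega), hs₂m]) (by omega) (by rw [hs₃0]; omega)
    have hT : k ≤ T.eval (A + B + d.size + 2) := h4.trans (eval_mono T (by omega))
    have e1 : Exec (.assign 0 (.cons (.hd (.var (m + 1))) (.cons (.var 0) (.var m)))) s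
        (Exp.cost s (.cons (.hd (.var (m + 1))) (.cons (.var 0) (.var m))) + 1) s₁ := by
      have := Exec.assign 0 (.cons (.hd (.var (m + 1))) (.cons (.var 0) (.var m))) s
      simp only [Exp.eval, hl, hd, Data.hd] at this
      exact this
    have e3 : Exec (.assign (m + 1) (.tl (.var (m + 1)))) s₂
        (Exp.cost s₂ (.tl (.var (m + 1))) + 1) s₃ := by
      have := Exec.assign (m + 1) (.tl (.var (m + 1))) s₂
      simp only [Exp.eval, hs₂, Data.tl] at this
      exact this
    refine ⟨_, s₄, .loop_step (by simp [Exp.eval, hl]) (.seq e1 (.seq h1 e3)) h1', ?_, ?_, ?_, h5'⟩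
    · rw [h2', hs₃0, List.foldl_cons]
    · intro i hi
      rw [h3' i hi, hs₃, Function.update_of_ne (by omega), h3 i (by omega), hs₁,
        Function.update_of_ne (by omega)]
    · simp only [Exp.cost, Exp.eval, hl, hd, hs₂, Data.hd, Data.tl, Data.size]
      omega

/-- Folding a list in polynomial time: if each step can be computed in polynomial time, and enlarges
the accumulator by an amount that is polynomial in the size of the input `d` and of
the current list entry, then the whole fold can be computed in polynomial time. -/
theorem IsPolyTime.foldl {l init : Data → Data} {g : Data → Data → Data → Data}
    (hl : IsPolyTime l) (hinit : IsPolyTime init)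
    (hg : IsPolyTime fun t => g t.hd t.tl.hd t.tl.tl) (q : Polynomial ℕ)
    (hq : ∀ x acc d, (g x acc d).size ≤ acc.size + q.eval (x.size + d.size)) :
    IsPolyTime fun d => (l d).toList.foldl (fun acc x => g x acc d) (init d) := by
  obtain ⟨p₀, m₀, T₀, hm₀, hp₀⟩ := hl
  obtain ⟨p, m, T, hm, hp⟩ := hinit
  obtain ⟨p', m', T', hm', hp'⟩ := hg
  set M := max m₀ (max m m') with hMdef
  have hM₀ : m₀ ≤ M := le_max_left _ _
  have hM : m ≤ M := (le_max_left _ _).trans (le_max_right _ _)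
  have hM' : m' ≤ M := (le_max_right _ _).trans (le_max_right _ _)
  let A : Polynomial ℕ := T + T₀ * q.comp (T₀ + .X)
  let W : Polynomial ℕ := A + T₀ + .X + 2
  refine ⟨.seq (p₀.keep M) (.seq p (p'.foldLoop M)), M + 2,
    (2 * T₀ + 2 * .X + 3) + T + (T₀ * (T'.comp W + 6 * W) + T₀ + 1) + A, by omega, fun s => ?_⟩
  obtain ⟨k, s₁, h1, h2, h3, h4, h5, h6⟩ := (hp₀.mono hM₀).keep (hm₀.trans_le hM₀) s
  obtain ⟨-, -, -, -, -, -, hsz⟩ := hp₀ s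
  obtain ⟨k', s₂, h1', h2', h3', h4', h5'⟩ := hp.mono hM s₁
  rw [h2] at h2' h4' h5'
  have hlen := ((l (s 0)).length_toList_le).trans hsz
  have hA : A.eval (s 0).size = T.eval (s 0).size +
      T₀.eval (s 0).size * q.eval (T₀.eval (s 0).size + (s 0).size) := by
    simp [A, Polynomial.eval_comp]
  obtain ⟨k'', s₃, h1'', h2'', h3'', h4'', h5''⟩ := (hp'.mono hM').foldLoop (d := s 0)
    (hm'.trans_le hM') (A := A.eval (s 0).size) (B := T₀.eval (s 0).size)
    (G := q.eval (T₀.eval (s 0).size + (s 0).size))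
    (fun x acc hx => (hq x acc _).trans (Nat.add_le_add_left (eval_mono q (by omega)) _))
    (l (s 0)) s₂ (by rw [h3' _ (by omega), h4]) (by rw [h3' _ le_rfl, h3]) hsz
    (by
      rw [h2', hA]
      exact Nat.add_le_add h5' (Nat.mul_le_mul_right _ hlen))
  rw [h2'] at h2''
  refine ⟨_, s₃, .seq h1 (.seq h1' h1''), h2'', ?_, ?_, ?_⟩
  · intro i hi
    rw [h3'' i hi, h3' i (by omega), h5 i hi]
  · have hW : W.eval (s 0).size = A.eval (s 0).size + T₀.eval (s 0).size + (s 0).size + 2 := by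
      simp [W]
    have := Nat.mul_le_mul_right (T'.eval (W.eval (s 0).size) + 6 * W.eval (s 0).size) hlen
    simp only [Polynomial.eval_add, Polynomial.eval_mul, Polynomial.eval_ofNat, Polynomial.eval_X,
      Polynomial.eval_comp, Polynomial.eval_one]
    rw [← hW] at h4''
    omega
  · beta_reduce
    rw [← h2'']
    exact h5''.trans ((Nat.le_add_left _ _).trans_eq Polynomial.eval_add.symm)

end PolyTime

/-! ### List operations in polynomial time -/

section PolyList

/-- The tree of a list of trees. -/
def Data.ofTrees (l : List Data) : Data := Data.ofList _root_.id l

@[simp] theorem Data.toList_ofTrees (l : List Data) : (Data.ofTrees l).toList = l := by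
  simp [Data.ofTrees, Data.toList_ofList]

@[simp] theorem Data.ofTrees_toList (d : Data) : Data.ofTrees d.toList = d :=
  Data.ofList_id_toList d

theorem Data.ofList_eq_ofTrees {β : Type*} (f : β → Data) (l : List β) :
    Data.ofList f l = Data.ofTrees (l.map f) := by
  rw [← Data.toList_ofList, Data.ofTrees_toList]

@[simp] theorem Data.size_ofTrees_nil : (Data.ofTrees []).size = 1 := rfl

@[simp] theorem Data.size_ofTrees_cons (a : Data) (l : List Data) :
    (Data.ofTrees (a :: l)).size = a.size + (Data.ofTrees l).size + 1 := rfl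

theorem Data.size_ofTrees_append (l l' : List Data) :
    (Data.ofTrees (l ++ l')).size + 1 = (Data.ofTrees l).size + (Data.ofTrees l').size := by
  induction l with
  | nil => simp [add_comm]
  | cons a l ih =>
    rw [List.cons_append, Data.size_ofTrees_cons, Data.size_ofTrees_cons]
    omega

theorem Data.size_ofTrees_filter_le (P : Data → Bool) (l : List Data) :
    (Data.ofTrees (l.filter P)).size ≤ (Data.ofTrees l).size := by
  induction l with
  | nil => rfl
  | cons a l ih =>
    rw [List.filter_cons]
    split_ifs <;> simp only [Data.size_ofTrees_cons] <;> omega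

/-- The list-valued function `l` on trees is computed by some program in polynomial time. -/
def IsPolyList (l : Data → List Data) : Prop := IsPolyTime fun d => Data.ofTrees (l d)

theorem IsPolyTime.exists_size_le {f : Data → Data} (hf : IsPolyTime f) :
    ∃ T : Polynomial ℕ, ∀ d, (f d).size ≤ T.eval d.size := by
  obtain ⟨p, m, T, -, hp⟩ := hf
  refine ⟨T, fun d => ?_⟩
  obtain ⟨-, -, -, -, -, -, h⟩ := hp fun _ => d
  exact h

theorem IsPolyTime.toList {f : Data → Data} (hf : IsPolyTime f) :
    IsPolyList fun d => (f d).toList := by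
  simpa [IsPolyList] using hf

theorem IsPolyList.nil : IsPolyList fun _ => [] := IsPolyTime.nil

theorem IsPolyList.cons {f : Data → Data} {l : Data → List Data} (hf : IsPolyTime f)
    (hl : IsPolyList l) : IsPolyList fun d => f d :: l d := IsPolyTime.cons hf hl

theorem IsPolyList.comp {l : Data → List Data} {f : Data → Data} (hl : IsPolyList l)
    (hf : IsPolyTime f) : IsPolyList fun d => l (f d) := IsPolyTime.comp hl hf

theorem IsPolyList.ite {P : Data → Bool} {l l' : Data → List Data} (hP : IsPolyBool P)
    (hl : IsPolyList l) (hl' : IsPolyList l') : IsPolyList fun d => if P d then l d else l' d := by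
  have := IsPolyTime.ite hP hl hl'
  simpa only [IsPolyList, apply_ite Data.ofTrees] using this

theorem IsPolyList.foldl {l init : Data → List Data} {g : Data → List Data → Data → List Data}
    (hl : IsPolyList l) (hinit : IsPolyList init)
    (hg : IsPolyList fun t => g t.hd t.tl.hd.toList t.tl.tl) (q : Polynomial ℕ)
    (hq : ∀ x acc d, (Data.ofTrees (g x acc d)).size ≤
      (Data.ofTrees acc).size + q.eval (x.size + d.size)) :
    IsPolyList fun d => (l d).foldl (fun acc x => g x acc d) (init d) := by
  have := IsPolyTime.foldl (g := fun x a d => Data.ofTrees (g x a.toList d)) hl hinit hg q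
    fun x acc d => by simpa using hq x acc.toList d
  unfold IsPolyList
  convert this using 2 with d
  rw [Data.toList_ofTrees]
  exact (List.foldl_hom Data.ofTrees fun acc x => by simp).symm

theorem IsPolyList.reverse {l : Data → List Data} (hl : IsPolyList l) :
    IsPolyList fun d => (l d).reverse := by
  have := IsPolyList.foldl (g := fun x acc _ => x :: acc) hl IsPolyList.nil
    (.cons (.hd .id) (.toList (.hd (.tl .id)))) (.X + 1) fun x acc d => by
      simp only [Data.size_ofTrees_cons, Polynomial.eval_add, Polynomial.eval_X,
        Polynomial.eval_one]
      omega
  simpa using this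

theorem IsPolyList.foldr {l init : Data → List Data} {g : Data → List Data → Data → List Data}
    (hl : IsPolyList l) (hinit : IsPolyList init)
    (hg : IsPolyList fun t => g t.hd t.tl.hd.toList t.tl.tl) (q : Polynomial ℕ)
    (hq : ∀ x acc d, (Data.ofTrees (g x acc d)).size ≤
      (Data.ofTrees acc).size + q.eval (x.size + d.size)) :
    IsPolyList fun d => (l d).foldr (fun x acc => g x acc d) (init d) := by
  simpa using hl.reverse.foldl hinit hg q hq

theorem IsPolyList.append {l l' : Data → List Data} (hl : IsPolyList l) (hl' : IsPolyList l') :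
    IsPolyList fun d => l d ++ l' d := by
  have := IsPolyList.foldr (g := fun x acc _ => x :: acc) hl hl'
    (.cons (.hd .id) (.toList (.hd (.tl .id)))) (.X + 1) fun x acc d => by
      simp only [Data.size_ofTrees_cons, Polynomial.eval_add, Polynomial.eval_X,
        Polynomial.eval_one]
      omega
  simpa using this

theorem IsPolyList.filter {l : Data → List Data} {P : Data → Data → Bool} (hl : IsPolyList l)
    (hP : IsPolyBool fun t => P t.hd t.tl) : IsPolyList fun d => (l d).filter fun x => P x d := by
  have hP' : IsPolyBool fun t => P t.hd t.tl.tl :=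
    IsPolyTime.comp (f := fun t => Data.ofBool (P t.hd t.tl)) hP
      (.cons (.hd .id) (.tl (.tl .id)))
  have := IsPolyList.foldr (g := fun x acc d => if P x d then x :: acc else acc) hl .nil
    (.ite hP' (.cons (.hd .id) (.toList (.hd (.tl .id)))) (.toList (.hd (.tl .id))))
    (.X + 1) fun x acc d => by
      simp only [Polynomial.eval_add, Polynomial.eval_X, Polynomial.eval_one]
      split_ifs <;> (try simp only [Data.size_ofTrees_cons]) <;> omega
  convert this using 2 with d
  induction l d with
  | nil => rfl
  | cons a l ih => simp only [List.filter_cons, List.foldr_cons, ih]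

theorem IsPolyList.flatMap {l : Data → List Data} {f : Data → Data → List Data}
    (hl : IsPolyList l) (hf : IsPolyList fun t => f t.hd t.tl) :
    IsPolyList fun d => (l d).flatMap fun x => f x d := by
  have hf' : IsPolyList fun t => f t.hd t.tl.tl :=
    IsPolyList.comp (l := fun t => f t.hd t.tl) hf (.cons (.hd .id) (.tl (.tl .id)))
  obtain ⟨T, hT⟩ := IsPolyTime.exists_size_le hf
  have := IsPolyList.foldr (g := fun x acc d => f x d ++ acc) hl .nil
    (.append hf' (.toList (.hd (.tl .id)))) (T.comp (.X + 1)) fun x acc d => by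
      have h1 := Data.size_ofTrees_append (f x d) acc
      have h2 := hT (.cons x d)
      simp only [Data.hd, Data.tl, Data.size] at h2
      simp only [Polynomial.eval_comp, Polynomial.eval_add, Polynomial.eval_X,
        Polynomial.eval_one]
      omega
  convert this using 2 with d
  induction l d with
  | nil => rfl
  | cons a l ih => simp [ih]

theorem IsPolyList.map {l : Data → List Data} {f : Data → Data → Data}
    (hl : IsPolyList l) (hf : IsPolyTime fun t => f t.hd t.tl) :
    IsPolyList fun d => (l d).map fun x => f x d := by
  have := hl.flatMap (f := fun x d => [f x d]) (.cons hf .nil)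
  simpa only [← List.map_eq_flatMap] using this

theorem IsPolyBool.const (b : Bool) : IsPolyBool fun _ => b := by
  cases b
  · exact IsPolyTime.nil
  · exact IsPolyTime.cons .nil .nil

theorem IsPolyBool.ite {P Q R : Data → Bool} (hP : IsPolyBool P) (hQ : IsPolyBool Q)
    (hR : IsPolyBool R) : IsPolyBool fun d => if P d then Q d else R d := by
  have := IsPolyTime.ite hP hQ hR
  simpa only [IsPolyBool, apply_ite Data.ofBool] using this

theorem IsPolyBool.not {P : Data → Bool} (hP : IsPolyBool P) : IsPolyBool fun d => !P d := by
  convert hP.ite (.const false) (.const true) using 2 with d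
  cases P d <;> rfl

theorem IsPolyBool.and {P Q : Data → Bool} (hP : IsPolyBool P) (hQ : IsPolyBool Q) :
    IsPolyBool fun d => P d && Q d := by
  convert hP.ite hQ (.const false) using 2 with d
  cases P d <;> rfl

theorem IsPolyBool.all {l : Data → List Data} {P : Data → Data → Bool} (hl : IsPolyList l)
    (hP : IsPolyBool fun t => P t.hd t.tl) : IsPolyBool fun d => (l d).all fun x => P x d := by
  have h := hl.filter (P := fun x d => !P x d) hP.not
  convert IsPolyBool.eq h .nil using 2 with d
  rw [Bool.eq_iff_iff, List.all_eq_true, decide_eq_true_iff]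
  have : ∀ l : List Data, Data.ofTrees l = Data.nil ↔ l = [] := fun l => by
    cases l <;> simp [Data.ofTrees, Data.ofList]
  simp [this]

theorem IsPolyBool.mem {f : Data → Data} {l : Data → List Data} (hf : IsPolyTime f)
    (hl : IsPolyList l) : IsPolyBool fun d => decide (f d ∈ l d) := by
  have h := IsPolyBool.all hl (P := fun x d => !decide (x = f d))
    (.not (.eq (.hd .id) (.comp hf (.tl .id))))
  convert h.not using 2 with d
  rw [Bool.eq_iff_iff]
  simp

end PolyList

/-! ### The optimization algorithm -/

section Algorithm

open Data

/-- One round of forward chaining: the implications of `S`, which have one conclusion each and are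
written as trees `cons A b`, are applied to `X` one after the other. -/
def derive (S X : List Data) : List Data :=
  S.foldl (fun X i => if i.hd.toList.all fun p => decide (p ∈ X) then i.tl :: X else X) X

/-- Forward chaining, with as many rounds as there are elements of the ground set. -/
def saturate (U S X : List Data) : List Data := U.foldl (fun X _ => derive S X) X

/-- Splits the implications of `L` into implications with one conclusion each. -/
def unitList (L : List Data) : List Data :=
  L.flatMap fun i => i.tl.toList.map fun b => .cons i.hd b

/-- The extreme points of `X`, in the order of `U`. -/
def extremeList (U S X : List Data) : List Data :=
  U.filter fun x => decide (x ∈ X) &&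
    !decide (x ∈ saturate U S (X.filter fun y => !decide (y = x)))

/-- For every premise in `L` with closure `C`, the implications from the extreme points of `C` to
the elements of `C`. -/
def saturatedList (U S L : List Data) : List Data :=
  L.flatMap fun i =>
    (U.filter fun b => decide (b ∈ saturate U S i.hd.toList)).map fun b =>
      .cons (ofTrees (extremeList U S (saturate U S i.hd.toList))) b

/-- Removes the implication `i` from `S` if it follows from the remaining ones. -/
def pruneStep (U S : List Data) (i : Data) : List Data :=
  if decide (i.tl ∈ saturate U (S.filter fun j => !decide (j = i)) i.hd.toList) then
    S.filter fun j => !decide (j = i)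
  else S

/-- The premises of `S`, each one listed once. -/
def premiseList (S : List Data) : List Data :=
  S.foldl (fun acc i => if decide (i.hd ∈ acc) then acc else i.hd :: acc) []

/-- Merges the implications of `S` that have the same premise. -/
def aggregateList (U S : List Data) : List Data :=
  (premiseList S).map fun P => .cons P (ofTrees (U.filter fun b => decide (.cons P b ∈ S)))

/-- The list of all implications from extreme points, pruned greedily. -/
def prunedList (U L : List Data) : List Data :=
  (saturatedList U (unitList L) L).foldl (pruneStep U) (saturatedList U (unitList L) L)

/-- The optimization algorithm. The input is a pair of a ground set and a list of implications; the
ground set is copied to the output. -/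
def optimize (d : Data) : Data :=
  .cons d.hd (ofTrees (aggregateList d.hd.toList (prunedList d.hd.toList d.tl.toList)))

theorem size_derive_le (S X : List Data) :
    (ofTrees (derive S X)).size ≤ (ofTrees X).size + (ofTrees S).size := by
  unfold derive
  induction S generalizing X with
  | nil => simp
  | cons i S ih =>
    rw [List.foldl_cons]
    refine (ih _).trans ?_
    have := i.size_tl_le
    split_ifs <;> (try simp only [size_ofTrees_cons]) <;> omega

theorem isPolyList_derive {s x : Data → List Data} (hs : IsPolyList s) (hx : IsPolyList x) :
    IsPolyList fun d => derive (s d) (x d) := by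
  refine IsPolyList.foldl
    (g := fun i X _ => if i.hd.toList.all fun p => decide (p ∈ X) then i.tl :: X else X) hs hx
    ?_ (.X + 1) fun i X d => ?_
  · refine .ite ?_ (.cons (.tl (.hd .id)) (.toList (.hd (.tl .id)))) (.toList (.hd (.tl .id)))
    exact IsPolyBool.all (P := fun p t => decide (p ∈ t.tl.hd.toList)) (.toList (.hd (.hd .id)))
      (.mem (.hd .id) (.toList (.hd (.tl (.tl .id)))))
  · have := i.size_tl_le
    simp only [Polynomial.eval_add, Polynomial.eval_X, Polynomial.eval_one]
    split_ifs <;> (try simp only [size_ofTrees_cons]) <;> omega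

theorem isPolyList_saturate {u s x : Data → List Data} (hu : IsPolyList u) (hs : IsPolyList s)
    (hx : IsPolyList x) : IsPolyList fun d => saturate (u d) (s d) (x d) := by
  obtain ⟨T, hT⟩ := IsPolyTime.exists_size_le hs
  refine IsPolyList.foldl (g := fun _ X d => derive (s d) X) hu hx
    (isPolyList_derive (.comp hs (.tl (.tl .id))) (.toList (.hd (.tl .id)))) T fun i X d => ?_
  have h1 := hT d
  have h2 := eval_mono T (Nat.le_add_left d.size i.size)
  have h3 := size_derive_le (s d) X
  omega

theorem isPolyList_unitList {l : Data → List Data} (hl : IsPolyList l) :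
    IsPolyList fun d => unitList (l d) :=
  hl.flatMap (f := fun i _ => i.tl.toList.map fun b => .cons i.hd b)
    (IsPolyList.map (f := fun b t => .cons t.hd.hd b) (.toList (.tl (.hd .id)))
      (.cons (.hd (.hd (.tl .id))) (.hd .id)))

theorem isPolyList_extremeList {u s x : Data → List Data} (hu : IsPolyList u) (hs : IsPolyList s)
    (hx : IsPolyList x) : IsPolyList fun d => extremeList (u d) (s d) (x d) := by
  refine hu.filter (P := fun y d => decide (y ∈ x d) &&
    !decide (y ∈ saturate (u d) (s d) ((x d).filter fun z => !decide (z = y)))) (.and ?_ (.not ?_))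
  · exact .mem (.hd .id) (.comp hx (.tl .id))
  · refine .mem (.hd .id) (isPolyList_saturate (.comp hu (.tl .id)) (.comp hs (.tl .id)) ?_)
    exact IsPolyList.filter (P := fun z t => !decide (z = t.hd)) (.comp hx (.tl .id))
      (.not (.eq (.hd .id) (.hd (.tl .id))))

theorem isPolyList_saturatedList {u s l : Data → List Data} (hu : IsPolyList u)
    (hs : IsPolyList s) (hl : IsPolyList l) :
    IsPolyList fun d => saturatedList (u d) (s d) (l d) := by
  have hsat : IsPolyList fun t => saturate (u t.tl) (s t.tl) t.hd.hd.toList :=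
    isPolyList_saturate (.comp hu (.tl .id)) (.comp hs (.tl .id)) (.toList (.hd (.hd .id)))
  refine hl.flatMap (f := fun i d =>
    ((u d).filter fun b => decide (b ∈ saturate (u d) (s d) i.hd.toList)).map fun b =>
      .cons (ofTrees (extremeList (u d) (s d) (saturate (u d) (s d) i.hd.toList))) b) ?_
  refine IsPolyList.map (f := fun b t =>
    .cons (ofTrees (extremeList (u t.tl) (s t.tl) (saturate (u t.tl) (s t.tl) t.hd.hd.toList))) b)
    ?_ (.cons ?_ (.hd .id))
  · exact IsPolyList.filter
      (P := fun b t => decide (b ∈ saturate (u t.tl) (s t.tl) t.hd.hd.toList))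
      (.comp hu (.tl .id)) (.mem (.hd .id) (.comp hsat (.tl .id)))
  · exact isPolyList_extremeList (.comp hu (.tl (.tl .id))) (.comp hs (.tl (.tl .id)))
      (.comp hsat (.tl .id))

theorem isPolyList_prunedList {u l : Data → List Data} (hu : IsPolyList u) (hl : IsPolyList l) :
    IsPolyList fun d => prunedList (u d) (l d) := by
  have hsat := isPolyList_saturatedList hu (isPolyList_unitList hl) hl
  refine IsPolyList.foldl (g := fun i S d => pruneStep (u d) S i) hsat hsat ?_ 0 fun i S d => ?_
  · have hfilter : IsPolyList fun t => t.tl.hd.toList.filter fun j => !decide (j = t.hd) :=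
      IsPolyList.filter (P := fun j t => !decide (j = t.hd)) (.toList (.hd (.tl .id)))
        (.not (.eq (.hd .id) (.hd (.tl .id))))
    exact .ite (.mem (.tl (.hd .id)) (isPolyList_saturate (.comp hu (.tl (.tl .id))) hfilter
      (.toList (.hd (.hd .id))))) hfilter (.toList (.hd (.tl .id)))
  · unfold pruneStep
    split_ifs
    · exact (size_ofTrees_filter_le _ _).trans (Nat.le_add_right _ _)
    · exact Nat.le_add_right _ _

theorem isPolyList_aggregateList {u s : Data → List Data} (hu : IsPolyList u)
    (hs : IsPolyList s) : IsPolyList fun d => aggregateList (u d) (s d) := by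
  refine IsPolyList.map (l := fun d => premiseList (s d))
    (f := fun P d => .cons P (ofTrees ((u d).filter fun b => decide (.cons P b ∈ s d)))) ?_ ?_
  · refine IsPolyList.foldl
      (g := fun i acc _ => if decide (i.hd ∈ acc) then acc else i.hd :: acc) hs .nil
      (.ite (.mem (.hd (.hd .id)) (.toList (.hd (.tl .id)))) (.toList (.hd (.tl .id)))
        (.cons (.hd (.hd .id)) (.toList (.hd (.tl .id))))) (.X + 1) fun i acc d => ?_
    have := i.size_hd_le
    simp only [Polynomial.eval_add, Polynomial.eval_X, Polynomial.eval_one]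
    split_ifs <;> (try simp only [size_ofTrees_cons]) <;> omega
  · refine .cons (.hd .id) ?_
    exact IsPolyList.filter (P := fun b t => decide (.cons t.hd b ∈ s t.tl)) (.comp hu (.tl .id))
      (.mem (.cons (.hd (.tl .id)) (.hd .id)) (.comp hs (.tl (.tl .id))))

theorem isPolyTime_optimize : IsPolyTime optimize :=
  .cons (.hd .id) (isPolyList_aggregateList (.toList (.hd .id))
    (isPolyList_prunedList (.toList (.hd .id)) (.toList (.tl .id))))

end Algorithm

/-! ### Encodings of elements, sets and implications -/

section Encoding

open Data

theorem Data.ofBool_injective : Function.Injective Data.ofBool := by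
  intro a b h
  cases a <;> cases b <;> simp_all [Data.ofBool]

theorem Data.ofNat_injective : Function.Injective Data.ofNat := by
  intro a b h
  have h1 := congrArg Data.toList h
  simp only [Data.ofNat, Data.toList_ofList] at h1
  have h2 := List.map_injective_iff.2 Data.ofBool_injective h1
  refine Nat.digits.injective 2 ?_
  rw [Nat.digits_two_eq_bits, Nat.digits_two_eq_bits, h2]

variable {n : ℕ}

/-- The tree of an element of the ground set. -/
def encElem (x : Fin n) : Data := Data.ofNat x

theorem encElem_injective : Function.Injective (encElem (n := n)) :=
  Data.ofNat_injective.comp Fin.val_injective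

/-- The set of elements whose trees occur in a list. -/
def decSet (X : List Data) : Finset (Fin n) := Finset.univ.filter fun x => encElem x ∈ X

@[simp] theorem mem_decSet {X : List Data} {x : Fin n} : x ∈ decSet X ↔ encElem x ∈ X := by
  simp [decSet]

theorem decSet_map (l : List (Fin n)) : decSet (l.map encElem) = l.toFinset := by
  ext x
  simp [encElem_injective.eq_iff]

theorem decSet_cons (b : Fin n) (X : List Data) :
    decSet (encElem b :: X) = insert b (decSet X) := by
  ext x
  simp [encElem_injective.eq_iff]

/-- The elements of a set in increasing order. -/
def sortedList (F : Finset (Fin n)) : List (Fin n) :=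
  (List.finRange n).filter fun x => decide (x ∈ F)

theorem nodup_sortedList (F : Finset (Fin n)) : (sortedList F).Nodup :=
  (List.nodup_finRange n).filter _

@[simp] theorem toFinset_sortedList (F : Finset (Fin n)) : (sortedList F).toFinset = F := by
  ext x
  simp [sortedList]

/-- The canonical tree of a set: its elements are listed in increasing order. -/
def encSet (F : Finset (Fin n)) : Data := ofTrees ((sortedList F).map encElem)

theorem toList_encSet (F : Finset (Fin n)) :
    (encSet F).toList = (sortedList F).map encElem := toList_ofTrees _

theorem decSet_toList_encSet (F : Finset (Fin n)) : decSet (encSet F).toList = F := by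
  rw [toList_encSet, decSet_map, toFinset_sortedList]

theorem encSet_injective : Function.Injective (encSet (n := n)) :=
  Function.LeftInverse.injective (g := fun d => decSet d.toList) fun F => decSet_toList_encSet F

/-- The canonical tree of an implication with one conclusion. -/
def encUnit (i : Finset (Fin n) × Fin n) : Data := .cons (encSet i.1) (encElem i.2)

theorem encUnit_injective : Function.Injective (encUnit (n := n)) := by
  rintro ⟨A, a⟩ ⟨B, b⟩ h
  simp only [encUnit, Data.cons.injEq] at h
  rw [encSet_injective h.1, encElem_injective h.2]

/-- The trees of the elements of the ground set. -/
def groundList (n : ℕ) : List Data := (List.finRange n).map encElem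

theorem groundList_eq (n : ℕ) : groundList n = (List.range n).map Data.ofNat := by
  rw [← List.map_coe_finRange_eq_range, List.map_map]
  rfl

theorem filter_groundList {P : Data → Bool} {F : Finset (Fin n)}
    (h : ∀ x : Fin n, P (encElem x) = true ↔ x ∈ F) :
    (groundList n).filter P = (sortedList F).map encElem := by
  rw [groundList, List.filter_map, sortedList]
  congr 1
  refine List.filter_congr fun x _ => ?_
  rw [Bool.eq_iff_iff, decide_eq_true_iff]
  exact h x

/-- The list `l` lists the implications of `S`; each premise may be listed in any order, and
repetitions are allowed. -/
def ListsUnits (l : List Data) (S : Finset (Finset (Fin n) × Fin n)) : Prop :=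
  (∀ t ∈ l, ∃ (A : List (Fin n)) (b : Fin n),
    t = .cons (ofTrees (A.map encElem)) (encElem b) ∧ (A.toFinset, b) ∈ S) ∧
  ∀ i ∈ S, ∃ A : List (Fin n), A.toFinset = i.1 ∧
    Data.cons (ofTrees (A.map encElem)) (encElem i.2) ∈ l

/-- The list `l` lists the canonical trees of the implications of `S`; repetitions are allowed. -/
def ListsCanonically (l : List Data) (S : Finset (Finset (Fin n) × Fin n)) : Prop :=
  ∀ t, t ∈ l ↔ ∃ i ∈ S, encUnit i = t

theorem ListsCanonically.listsUnits {l : List Data} {S : Finset (Finset (Fin n) × Fin n)}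
    (h : ListsCanonically l S) : ListsUnits l S := by
  constructor
  · intro t ht
    obtain ⟨i, hi, rfl⟩ := (h t).1 ht
    exact ⟨sortedList i.1, i.2, rfl, by simpa using hi⟩
  · intro i hi
    exact ⟨sortedList i.1, toFinset_sortedList _, (h _).2 ⟨i, hi, rfl⟩⟩

end Encoding

/-! ### Correctness of the algorithm -/

section Correctness

open Data

variable {n : ℕ} {c : ClosureOperator (Finset (Fin n))}

theorem premise_subset_iff {A : List (Fin n)} {X : List Data} :
    ((ofTrees (A.map encElem)).toList.all fun p => decide (p ∈ X)) = true ↔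
      A.toFinset ⊆ decSet X := by
  simp [Finset.subset_iff]

theorem derive_cons (i : Data) (l X : List Data) :
    derive (i :: l) X =
      derive l (if i.hd.toList.all fun p => decide (p ∈ X) then i.tl :: X else X) := rfl

theorem decSet_subset_derive (l X : List Data) :
    (decSet X : Finset (Fin n)) ⊆ decSet (derive l X) := by
  induction l generalizing X with
  | nil => rfl
  | cons i l ih =>
    rw [derive_cons]
    refine Finset.Subset.trans (fun x hx => ?_) (ih _)
    rw [mem_decSet] at hx ⊢
    split_ifs
    · exact List.mem_cons_of_mem _ hx
    · exact hx

theorem decSet_derive_subset {l : List Data} {S : Finset (Finset (Fin n) × Fin n)}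
    (hl : ∀ t ∈ l, ∃ (A : List (Fin n)) (b : Fin n),
      t = .cons (ofTrees (A.map encElem)) (encElem b) ∧ (A.toFinset, b) ∈ S)
    {X : List Data} {Z : Finset (Fin n)} (hZ : Satisfies S Z) (hX : decSet X ⊆ Z) :
    decSet (derive l X) ⊆ Z := by
  induction l generalizing X with
  | nil => exact hX
  | cons i l ih =>
    rw [derive_cons]
    refine ih (fun t ht => hl t (List.mem_cons_of_mem _ ht)) ?_
    obtain ⟨A, b, rfl, hA⟩ := hl i List.mem_cons_self
    simp only [Data.hd, Data.tl, premise_subset_iff]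
    split_ifs with h
    · rw [decSet_cons]
      exact Finset.insert_subset (hZ _ hA (h.trans hX)) hX
    · exact hX

theorem mem_derive_of_premise_subset {l X : List Data} {A : List (Fin n)} {b : Fin n}
    (h : Data.cons (ofTrees (A.map encElem)) (encElem b) ∈ l) (hA : A.toFinset ⊆ decSet X) :
    b ∈ decSet (derive l X) := by
  induction l generalizing X with
  | nil => simp at h
  | cons i l ih =>
    rw [derive_cons]
    rcases List.mem_cons.1 h with rfl | h
    · refine decSet_subset_derive _ _ ?_
      simp only [Data.hd, Data.tl, premise_subset_iff, if_pos hA]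
      simp
    · refine ih h (hA.trans fun x hx => ?_)
      rw [mem_decSet] at hx ⊢
      split_ifs
      · exact List.mem_cons_of_mem _ hx
      · exact hx

theorem decSet_derive_eq {l : List Data} {S : Finset (Finset (Fin n) × Fin n)}
    (hl : ListsUnits l S) {X : List Data} (h : Satisfies S (decSet X)) :
    decSet (derive l X) = (decSet X : Finset (Fin n)) :=
  (decSet_derive_subset hl.1 h subset_rfl).antisymm (decSet_subset_derive l X)

theorem decSet_subset_saturate (U l X : List Data) :
    (decSet X : Finset (Fin n)) ⊆ decSet (saturate U l X) := by
  induction U generalizing X with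
  | nil => rfl
  | cons u U ih => exact (decSet_subset_derive l X).trans (ih (derive l X))

theorem decSet_saturate_subset {l : List Data} {S : Finset (Finset (Fin n) × Fin n)}
    (hl : ListsUnits l S) (U : List Data) {X : List Data} {Z : Finset (Fin n)}
    (hZ : Satisfies S Z) (hX : decSet X ⊆ Z) : decSet (saturate U l X) ⊆ Z := by
  induction U generalizing X with
  | nil => exact hX
  | cons u U ih => exact ih (decSet_derive_subset hl.1 hZ hX)

/-- Each round of forward chaining adds an element unless all implications are satisfied. -/
theorem satisfies_saturate_or_le_card {l : List Data} {S : Finset (Finset (Fin n) × Fin n)}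
    (hl : ListsUnits l S) (U X : List Data) :
    Satisfies S (decSet (saturate U l X)) ∨
      U.length + (decSet X : Finset (Fin n)).card ≤
        (decSet (saturate U l X) : Finset (Fin n)).card := by
  induction U generalizing X with
  | nil => simp [saturate]
  | cons u U ih =>
    have hcons : saturate (u :: U) l X = saturate U l (derive l X) := rfl
    rw [hcons]
    by_cases hX : Satisfies S (decSet X)
    · left
      rwa [(decSet_saturate_subset hl U hX (decSet_derive_eq hl hX).le).antisymm
        ((decSet_subset_derive l X).trans (decSet_subset_saturate U l _))]
    · refine (ih (derive l X)).imp_right fun h => le_trans ?_ h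
      simp only [Satisfies] at hX
      push Not at hX
      obtain ⟨i, hi, hiX, hiX'⟩ := hX
      obtain ⟨A, hA, hAl⟩ := hl.2 i hi
      have := Finset.card_lt_card ((Finset.ssubset_iff_of_subset (decSet_subset_derive l X)).2
        ⟨i.2, mem_derive_of_premise_subset hAl (hA ▸ hiX), hiX'⟩)
      rw [List.length_cons]
      omega

theorem satisfies_saturate {l : List Data} {S : Finset (Finset (Fin n) × Fin n)}
    (hl : ListsUnits l S) (X : List Data) :
    Satisfies S (decSet (saturate (groundList n) l X)) := by
  refine (satisfies_saturate_or_le_card hl (groundList n) X).elim id fun h i _ _ => ?_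
  have hle : Fintype.card (Fin n) ≤
      (decSet (saturate (groundList n) l X) : Finset (Fin n)).card := by
    rw [groundList, List.length_map, List.length_finRange] at h
    rw [Fintype.card_fin, groundList]
    omega
  rw [(Finset.card_eq_iff_eq_univ _).1 (le_antisymm (Finset.card_le_univ _) hle)]
  exact Finset.mem_univ _

theorem decSet_saturate_eq {l : List Data} {S : Finset (Finset (Fin n) × Fin n)}
    (hl : ListsUnits l S) (hS : IsUnitBaseOf S c) (X : List Data) :
    decSet (saturate (groundList n) l X) = c (decSet X) := by
  refine (decSet_saturate_subset hl _ ((hS _).1 (c.isClosed_closure _))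
    (subset_closure _)).antisymm ?_
  exact c.closure_min (decSet_subset_saturate _ _ _) ((hS _).2 (satisfies_saturate hl X))

theorem ofTrees_extremeList {l : List Data} {S : Finset (Finset (Fin n) × Fin n)}
    (hl : ListsUnits l S) (hS : IsUnitBaseOf S c) (X : List Data) :
    ofTrees (extremeList (groundList n) l X) = encSet (extremePoints c (decSet X)) := by
  rw [extremeList, encSet]
  congr 1
  refine filter_groundList fun x => ?_
  have hX : decSet (X.filter fun y => !decide (y = encElem x)) = (decSet X).erase x := by
    ext y
    simp [encElem_injective.eq_iff, and_comm]
  rw [mem_extremePoints, ← hX, ← decSet_saturate_eq hl hS]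
  simp

/-- The unit base obtained from `S` by splitting the conclusions. -/
def splitUnits {α : Type*} [DecidableEq α] (S : ImplBase α) : Finset (Finset α × α) :=
  S.biUnion fun i => i.2.image fun b => (i.1, b)

theorem IsBaseOf.isUnitBaseOf_splitUnits {α : Type*} [DecidableEq α] {S : ImplBase α}
    {c : ClosureOperator (Finset α)} (hS : IsBaseOf S c) : IsUnitBaseOf (splitUnits S) c := by
  intro C
  rw [hS]
  simp only [Satisfies, splitUnits, Finset.mem_biUnion, Finset.mem_image]
  constructor
  · rintro h _ ⟨i, hi, b, hb, rfl⟩ hiC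
    exact h i hi hiC hb
  · intro h i hi hiC b hb
    exact h _ ⟨i, hi, b, hb, rfl⟩ hiC

/-- The trees of a list of implications. -/
def implTrees (L : List (List (Fin n) × List (Fin n))) : List Data :=
  L.map fun i => .cons (ofTrees (i.1.map encElem)) (ofTrees (i.2.map encElem))

theorem encodeBase_eq (L : List (List (Fin n) × List (Fin n))) :
    encodeBase n L = .cons (ofTrees (groundList n)) (ofTrees (implTrees L)) := by
  simp only [encodeBase, ofList_eq_ofTrees, groundList_eq, implTrees]
  rfl

theorem listsUnits_unitList (L : List (List (Fin n) × List (Fin n))) :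
    ListsUnits (unitList (implTrees L))
      (splitUnits (L.map fun i => (i.1.toFinset, i.2.toFinset)).toFinset) := by
  constructor
  · intro t ht
    simp only [unitList, implTrees, List.mem_flatMap, List.mem_map] at ht
    obtain ⟨_, ⟨i, hi, rfl⟩, b, hb, rfl⟩ := ht
    simp only [Data.tl, toList_ofTrees, List.mem_map] at hb
    obtain ⟨b, hb, rfl⟩ := hb
    refine ⟨i.1, b, rfl, ?_⟩
    simp only [splitUnits, Finset.mem_biUnion, Finset.mem_image, List.mem_toFinset, List.mem_map]
    exact ⟨_, ⟨i, hi, rfl⟩, b, by simpa using hb, rfl⟩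
  · intro j hj
    simp only [splitUnits, Finset.mem_biUnion, Finset.mem_image, List.mem_toFinset,
      List.mem_map] at hj
    obtain ⟨_, ⟨i, hi, rfl⟩, b, hb, rfl⟩ := hj
    refine ⟨i.1, rfl, ?_⟩
    simp only [unitList, implTrees, List.mem_flatMap, List.mem_map]
    refine ⟨_, ⟨i, hi, rfl⟩, encElem b, ?_, rfl⟩
    simpa [Data.tl, encElem_injective.eq_iff] using hb

theorem listsCanonically_saturatedList {l : List Data} {S : Finset (Finset (Fin n) × Fin n)}
    (hl : ListsUnits l S) (hS : IsUnitBaseOf S c) (L : List (List (Fin n) × List (Fin n))) :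
    ListsCanonically (saturatedList (groundList n) l (implTrees L))
      (saturatedUnits (L.map fun i => (i.1.toFinset, i.2.toFinset)).toFinset c) := by
  intro t
  have hdec : ∀ i : List (Fin n) × List (Fin n),
      decSet (saturate (groundList n) l (i.1.map encElem)) = c i.1.toFinset := fun i => by
    rw [decSet_saturate_eq hl hS, decSet_map]
  simp only [saturatedList, implTrees, List.mem_flatMap, List.mem_map, exists_exists_and_eq_and,
    saturatedUnits, Finset.mem_biUnion, List.mem_toFinset, Finset.mem_image, Data.hd,
    toList_ofTrees, ofTrees_extremeList hl hS, hdec]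
  constructor
  · rintro ⟨i, hi, b, hb, rfl⟩
    rw [List.mem_filter, groundList, List.mem_map] at hb
    obtain ⟨⟨b, -, rfl⟩, hb⟩ := hb
    rw [decide_eq_true_iff, ← groundList, ← mem_decSet, hdec] at hb
    exact ⟨_, ⟨i, hi, b, hb, rfl⟩, rfl⟩
  · rintro ⟨_, ⟨i, hi, b, hb, rfl⟩, rfl⟩
    refine ⟨i, hi, encElem b, ?_, rfl⟩
    rw [List.mem_filter, decide_eq_true_iff, ← mem_decSet (x := b) (X := saturate _ _ _), hdec]
    exact ⟨List.mem_map.2 ⟨b, List.mem_finRange b, rfl⟩, hb⟩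

theorem listsCanonically_filter {l : List Data} {S : Finset (Finset (Fin n) × Fin n)}
    (hl : ListsCanonically l S) (i : Finset (Fin n) × Fin n) :
    ListsCanonically (l.filter fun j => !decide (j = encUnit i)) (S.erase i) := by
  intro t
  rw [List.mem_filter, hl t]
  constructor
  · rintro ⟨⟨j, hj, rfl⟩, h⟩
    exact ⟨j, Finset.mem_erase.2 ⟨fun hji => by simp [hji] at h, hj⟩, rfl⟩
  · rintro ⟨j, hj, rfl⟩
    rw [Finset.mem_erase] at hj
    exact ⟨⟨j, hj.2, rfl⟩, by simpa [encUnit_injective.eq_iff] using hj.1⟩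

open Classical in
theorem listsCanonically_pruneStep {l : List Data} {S : Finset (Finset (Fin n) × Fin n)}
    (hl : ListsCanonically l S) (hS : IsUnitBaseOf S c) {i : Finset (Fin n) × Fin n}
    (hi : i.2 ∈ c i.1) :
    ListsCanonically (pruneStep (groundList n) l (encUnit i))
      (if IsUnitBaseOf (S.erase i) c then S.erase i else S) := by
  have hl' := listsCanonically_filter hl i
  have hu := hl'.listsUnits
  have hiff := hS.erase_iff hi
    (Y := decSet (saturate (groundList n)
      (l.filter fun j => !decide (j = encUnit i)) (encSet i.1).toList))
    ((decSet_toList_encSet i.1).symm.trans_subset (decSet_subset_saturate _ _ _))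
    (satisfies_saturate hu _)
    (fun Z hZ hZS => decSet_saturate_subset hu _ hZS (by rwa [decSet_toList_encSet]))
  rw [mem_decSet] at hiff
  rw [pruneStep]
  simp only [decide_eq_true_eq]
  by_cases h : IsUnitBaseOf (S.erase i) c
  · rw [if_pos h, if_pos (by exact hiff.1 h)]
    exact hl'
  · rw [if_neg h, if_neg (by exact fun h' => h (hiff.2 h'))]
    exact hl

theorem listsCanonically_foldl_pruneStep (L : List (Finset (Fin n) × Fin n))
    (hL : ∀ i ∈ L, i.2 ∈ c i.1) {l : List Data} {S : Finset (Finset (Fin n) × Fin n)}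
    (hl : ListsCanonically l S) (hS : IsUnitBaseOf S c) :
    ListsCanonically ((L.map encUnit).foldl (pruneStep (groundList n)) l) (prune c L S) := by
  classical
  induction L generalizing l S with
  | nil => exact hl
  | cons i L ih =>
    rw [List.map_cons, List.foldl_cons]
    have hstep := listsCanonically_pruneStep hl hS (hL i List.mem_cons_self)
    have hS' : IsUnitBaseOf (if IsUnitBaseOf (S.erase i) c then S.erase i else S) c := by
      split_ifs with h
      · exact h
      · exact hS
    have := ih (fun j hj => hL j (List.mem_cons_of_mem _ hj)) hstep hS'
    simp only [prune, List.foldl_cons] at this ⊢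
    convert this

theorem mem_premiseList_aux (S acc : List Data) (hacc : acc.Nodup) :
    (S.foldl (fun acc i => if decide (i.hd ∈ acc) then acc else i.hd :: acc) acc).Nodup ∧
      ∀ P, P ∈ S.foldl (fun acc i => if decide (i.hd ∈ acc) then acc else i.hd :: acc) acc ↔
        P ∈ acc ∨ ∃ i ∈ S, i.hd = P := by
  induction S generalizing acc with
  | nil => simpa using hacc
  | cons i S ih =>
    rw [List.foldl_cons]
    by_cases h : i.hd ∈ acc
    · rw [if_pos (decide_eq_true h)]
      refine ⟨(ih acc hacc).1, fun P => ((ih acc hacc).2 P).trans ?_⟩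
      simp only [List.mem_cons, exists_eq_or_imp]
      constructor
      · rintro (h | h)
        · exact Or.inl h
        · exact Or.inr (Or.inr h)
      · rintro (h' | rfl | h')
        · exact Or.inl h'
        · exact Or.inl h
        · exact Or.inr h'
    · rw [if_neg (by simpa using h)]
      have hn := List.nodup_cons.2 ⟨h, hacc⟩
      refine ⟨(ih _ hn).1, fun P => ((ih _ hn).2 P).trans ?_⟩
      simp only [List.mem_cons, exists_eq_or_imp, eq_comm (a := P), or_assoc, or_left_comm]

theorem exists_premiseList_eq {l : List Data} {S : Finset (Finset (Fin n) × Fin n)}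
    (hl : ListsCanonically l S) : ∃ F : List (Finset (Fin n)),
      premiseList l = F.map encSet ∧ F.Nodup ∧ F.toFinset = S.image Prod.fst := by
  obtain ⟨hnd, hmem⟩ := mem_premiseList_aux l [] List.nodup_nil
  have hmem' : ∀ P, P ∈ premiseList l ↔ ∃ i ∈ l, i.hd = P := fun P => by
    rw [premiseList, hmem P]
    simp
  refine ⟨(premiseList l).map fun P => decSet P.toList, ?_, ?_, ?_⟩
  · rw [List.map_map]
    refine (List.map_id _).symm.trans (List.map_congr_left fun P hP => ?_)
    obtain ⟨t, ht, rfl⟩ := (hmem' P).1 hP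
    obtain ⟨i, hi, rfl⟩ := (hl t).1 ht
    simp [encUnit, Data.hd, decSet_toList_encSet]
  · refine List.Nodup.map_on (fun P hP P' hP' h => ?_) hnd
    obtain ⟨t, ht, rfl⟩ := (hmem' P).1 hP
    obtain ⟨i, hi, rfl⟩ := (hl t).1 ht
    obtain ⟨t', ht', rfl⟩ := (hmem' P').1 hP'
    obtain ⟨i', hi', rfl⟩ := (hl t').1 ht'
    simp only [encUnit, Data.hd, decSet_toList_encSet] at h ⊢
    rw [h]
  · ext A
    simp only [List.mem_toFinset, List.mem_map, hmem', Finset.mem_image]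
    constructor
    · rintro ⟨_, ⟨t, ht, rfl⟩, rfl⟩
      obtain ⟨i, hi, rfl⟩ := (hl t).1 ht
      exact ⟨i, hi, by simp [encUnit, Data.hd, decSet_toList_encSet]⟩
    · rintro ⟨i, hi, rfl⟩
      exact ⟨_, ⟨encUnit i, (hl _).2 ⟨i, hi, rfl⟩, rfl⟩,
        by simp [encUnit, Data.hd, decSet_toList_encSet]⟩

theorem represents_aggregateList {l : List Data} {S : Finset (Finset (Fin n) × Fin n)}
    (hl : ListsCanonically l S) :
    Represents (.cons (ofTrees (groundList n)) (ofTrees (aggregateList (groundList n) l)))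
      (aggregate S) := by
  obtain ⟨F, hF, hnd, hFS⟩ := exists_premiseList_eq hl
  have hmap : (F.map fun A => (sortedList A,
      sortedList (Finset.univ.filter fun b => (A, b) ∈ S))).map
        (fun i => (i.1.toFinset, i.2.toFinset)) =
      F.map fun A => (A, Finset.univ.filter fun b => (A, b) ∈ S) := by
    simp
  refine ⟨F.map fun A => (sortedList A, sortedList (Finset.univ.filter fun b => (A, b) ∈ S)),
    ?_, ?_, ?_, ?_⟩
  · intro i hi
    obtain ⟨A, -, rfl⟩ := List.mem_map.1 hi
    exact ⟨nodup_sortedList _, nodup_sortedList _⟩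
  · rw [hmap]
    exact hnd.map fun A B h => (Prod.mk.injEq _ _ _ _ ▸ h).1
  · rw [hmap, aggregate, ← hFS]
    ext i
    simp
  · rw [encodeBase_eq, implTrees, aggregateList, hF, List.map_map, List.map_map]
    congr 2
    refine List.map_congr_left fun A _ => ?_
    simp only [Function.comp_apply]
    rw [filter_groundList (F := Finset.univ.filter fun b => (A, b) ∈ S) fun b => ?_]
    · rfl
    · rw [decide_eq_true_iff, hl, Finset.mem_filter]
      constructor
      · rintro ⟨i, hi, h⟩
        obtain rfl : i = (A, b) := encUnit_injective h
        exact ⟨Finset.mem_univ _, hi⟩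
      · rintro ⟨-, h⟩
        exact ⟨_, h, rfl⟩

/-- On every base of a closure system whose closed sets are generated by their extreme points and
whose quasi-closed hypergraphs have pairwise disjoint edges, the algorithm finds an optimum base. -/
theorem exists_represents_optimize {S : ImplBase (Fin n)} (hS : IsBaseOf S c) {t : Data}
    (ht : Represents t S) (hc : IsGeneratedByExtremePoints c)
    (hdisj : ∀ C, IsEssential c C → (qcEdges c C).PairwiseDisjoint id) :
    ∃ S', Represents (optimize t) S' ∧ IsOptimumBaseOf S' c := by
  obtain ⟨L, -, -, rfl, rfl⟩ := ht
  set S := (L.map fun i => (i.1.toFinset, i.2.toFinset)).toFinset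
  set l := saturatedList (groundList n) (unitList (implTrees L)) (implTrees L)
  have hsat : ListsCanonically l (saturatedUnits S c) :=
    listsCanonically_saturatedList (listsUnits_unitList L) hS.isUnitBaseOf_splitUnits L
  have hbase := isUnitBaseOf_saturatedUnits hS hc
  obtain ⟨L', hL'⟩ : l ∈ Set.range (List.map (encUnit (n := n))) := by
    rw [Set.range_list_map]
    intro t ht
    obtain ⟨i, -, hi⟩ := (hsat t).1 ht
    exact ⟨i, hi⟩
  have hmem : ∀ i, i ∈ L' ↔ i ∈ saturatedUnits S c := by
    intro i
    rw [← List.mem_map_of_injective encUnit_injective, hL', hsat]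
    simp [encUnit_injective.eq_iff]
  have hpruned : ListsCanonically (prunedList (groundList n) (implTrees L))
      (prune c L' (saturatedUnits S c)) := by
    have := listsCanonically_foldl_pruneStep L' (fun i hi => (hbase _).1 (c.isClosed_closure _) i
      ((hmem i).1 hi) (subset_closure _)) hsat hbase
    rwa [hL'] at this
  obtain ⟨h1, h2, h3⟩ := prune_spec L' hbase
  refine ⟨aggregate (prune c L' (saturatedUnits S c)), ?_, h1.isOptimumBaseOf_aggregate hdisj
    (fun i hi => fst_eq_of_mem_saturatedUnits hc (h2 hi))
    fun i hi => h3 i ((hmem i).2 (h2 hi)) hi⟩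
  have := represents_aggregateList hpruned
  simpa only [optimize, encodeBase_eq, Data.hd, Data.tl, toList_ofTrees] using this

/-- The pairwise disjointness of the edges is all that is needed to optimize in polynomial time. -/
theorem optimizableInPolyTime_of_pairwiseDisjoint
    {K : ∀ n : ℕ, ClosureOperator (Finset (Fin n)) → Prop}
    (hgen : ∀ n c, K n c → IsGeneratedByExtremePoints c)
    (hdisj : ∀ n c, K n c → ∀ C, IsEssential c C → (qcEdges c C).PairwiseDisjoint id) :
    OptimizableInPolyTime K := by
  obtain ⟨p, m, T, -, hp⟩ := isPolyTime_optimize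
  refine ⟨p, T, fun n c S t hK hS ht => ?_⟩
  obtain ⟨S', hS', hopt⟩ := exists_represents_optimize hS ht (hgen n c hK) (hdisj n c hK)
  obtain ⟨k, s', h1, h2, -, h3, -⟩ := hp (Function.update (fun _ => Data.nil) 0 t)
  rw [Function.update_self] at h2 h3
  exact ⟨k, optimize t, S', ⟨s', h1, h2⟩, h3, hS', hopt⟩

end Correctness

end ConvexGeom

theorem theorem3 :
    -- disjointness and the description of the edges
    (∀ (α : Type*) [Fintype α] [DecidableEq α] (c : ClosureOperator (Finset α)),
      ((ConvexGeom.IsDoubleShelling c ∨ ConvexGeom.IsAcyclicGeometry c ∨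
          ConvexGeom.IsAffineGeometry c ∨ ConvexGeom.IsAcceptant c) →
        ∀ C : Finset α, ConvexGeom.IsEssential c C →
          (ConvexGeom.qcEdges c C).PairwiseDisjoint id) ∧
      (∀ [PartialOrder α], ConvexGeom.IsDoubleShellingOf c →
        ∀ C : Finset α, ConvexGeom.IsEssential c C →
          ∃ x y : α, x < y ∧ (C : Set α) = Set.Icc x y ∧
            ConvexGeom.extremePoints c C = {x, y} ∧
            ConvexGeom.qcEdges c C = ConvexGeom.intervalComponents x y) ∧
      (ConvexGeom.IsAcyclicGeometry c →
        ∀ C : Finset α, ConvexGeom.IsEssential c C →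
          ∀ E ∈ ConvexGeom.qcEdges c C, ∃ x ∈ C, E = {x}) ∧
      (ConvexGeom.IsAffineGeometry c →
        ∀ C : Finset α, ConvexGeom.IsEssential c C →
          (∀ Q : Finset α, ConvexGeom.IsMaximalQuasiClosedOf c C Q ↔
            Q = ConvexGeom.extremePoints c C) ∧
          ConvexGeom.qcEdges c C = {C \ ConvexGeom.extremePoints c C}) ∧
      (ConvexGeom.IsAcceptant c →
        ∀ C : Finset α, ConvexGeom.IsEssential c C →
          (∃! Q : Finset α, ConvexGeom.IsMaximalQuasiClosedOf c C Q) ∧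
          ∃ E : Finset α, ConvexGeom.qcEdges c C = {E})) ∧
    -- optimization in polynomial time, by one program for all four classes
    ConvexGeom.OptimizableInPolyTime (fun _ c =>
      ConvexGeom.IsDoubleShelling c ∨ ConvexGeom.IsAcyclicGeometry c ∨
        ConvexGeom.IsAffineGeometry c ∨ ConvexGeom.IsAcceptant c) := by
  refine ⟨fun α _ _ c => ⟨fun h C hC => ConvexGeom.IsInFourClasses.pairwiseDisjoint_qcEdges h hC,
    fun {_} h C hC => ?_, fun ⟨_, S, hS, hac⟩ C _ E hE => hac.eq_singleton_of_mem_qcEdges hS hE,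
    fun h C hC => ⟨h.isMaximalQuasiClosedOf_iff hC, h.qcEdges_eq hC⟩, fun h C hC =>
      ⟨h.elim fun _ hq => hq.existsUnique_isMaximalQuasiClosedOf hC, h.exists_qcEdges_eq hC⟩⟩, ?_⟩
  · obtain ⟨Q, hQ, rfl⟩ := hC
    obtain ⟨x, y, hxy, hcl⟩ := h.exists_closure_pair hQ
    rw [← hcl]
    refine ⟨x, y, hxy, ?_, h.extremePoints_closure_pair hxy, h.qcEdges_eq_intervalComponents hxy⟩
    ext z
    exact h.mem_closure_pair hxy z
  · exact ConvexGeom.optimizableInPolyTime_of_pairwiseDisjoint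
      (fun _ _ h => ConvexGeom.IsInFourClasses.isGeneratedByExtremePoints h)
      fun _ _ h _ hC => ConvexGeom.IsInFourClasses.pairwiseDisjoint_qcEdges h hC
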